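/- Let $(X,\mathcal B,\mu)$ be a standard Borel space with a non-atomic probability measure, and let $\mathrm{Aut}$ be the group of its invertible measure-preserving transformations, where transformations that agree $\mu$-almost everywhere are identified. Equip $\mathrm{Aut}$ with the Halmos metric $$\rho(S,T)=\sum_{i\ge 0} 2^{-i}\bigl(\mu(SA_i\,\triangle\, TA_i)+\mu(S^{-1}A_i\,\triangle\, T^{-1}A_i)\bigr),$$ where $(A_i)_{i\ge 0}$ is any sequence of measurable sets that is dense in $\mathcal B$ for the distance $\mu(A\triangle B)$. A set of transformations is called typical if it contains a dense $G_\delta$ subset of $(\mathrm{Aut},\rho)$. Say that $T\in\mathrm{Aut}$ has property $(*)$ if there are sequences of natural numbers $m_i\to\infty$ and $n_i\to\infty$ (which may depend on $T$) such that for every measurable set $A$ $$\mu(A\cap T^{m_i}A\cap T^{n_i}A)\to \frac{\mu(A)+2\mu(A)^3}{3},\qquad \mu(A\cap T^{-m_i}A\cap T^{-n_i}A)\to \mu(A)^2 .$$ Then: 1. every $T\in\mathrm{Aut}$ with property $(*)$ is asymmetric, that is, $T$ and $T^{-1}$ are not conjugate in $\mathrm{Aut}$; 2. for every such sequence $(A_i)$,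 the set of $T\in\mathrm{Aut}$ with property $(*)$ is typical. -/

import Mathlib

open MeasureTheory Filter Topology
open scoped symmDiff

/-- The group of everywhere defined invertible bimeasurable transformations of `X` that
preserve `μ`; multiplication is composition. -/
def mpGroup {X : Type*} [MeasurableSpace X] (μ : Measure X) : Subgroup (Equiv.Perm X) where
  carrier := {T | MeasurePreserving T μ μ ∧ MeasurePreserving T.symm μ μ}
  mul_mem' := fun hS hT => ⟨hS.1.comp hT.1, hT.2.comp hS.2⟩
  one_mem' := ⟨MeasurePreserving.id μ, MeasurePreserving.id μ⟩
  inv_mem' := fun hT => ⟨hT.2, hT.1⟩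

/-- The transformations that coincide with the identity almost everywhere. -/
def aeTrivial {X : Type*} [MeasurableSpace X] (μ : Measure X) : Subgroup (mpGroup μ) where
  carrier := {T | ∀ᵐ x ∂μ, (T : Equiv.Perm X) x = x}
  mul_mem' := by
    intro S T hS hT
    change ∀ᵐ x ∂μ, ((S * T : mpGroup μ) : Equiv.Perm X) x = x
    filter_upwards [hS, hT] with x h1 h2
    have h : ((S * T : mpGroup μ) : Equiv.Perm X) x
        = (S : Equiv.Perm X) ((T : Equiv.Perm X) x) := rfl
    rw [h, h2, h1]
  one_mem' := by
    change ∀ᵐ x ∂μ, ((1 : mpGroup μ) : Equiv.Perm X) x = x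
    exact Eventually.of_forall fun _ => rfl
  inv_mem' := by
    intro T hT
    change ∀ᵐ x ∂μ, ((T⁻¹ : mpGroup μ) : Equiv.Perm X) x = x
    filter_upwards [hT] with x h
    exact (Equiv.symm_apply_eq (T : Equiv.Perm X)).2 h.symm

instance aeTrivial_normal {X : Type*} [MeasurableSpace X] (μ : Measure X) :
    (aeTrivial μ).Normal where
  conj_mem := by
    intro T hT S
    have h := S.2.2.quasiMeasurePreserving.ae hT
    change ∀ᵐ x ∂μ, ((S * T * S⁻¹ : mpGroup μ) : Equiv.Perm X) x = x
    filter_upwards [h] with x hx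
    have h1 : ((S * T * S⁻¹ : mpGroup μ) : Equiv.Perm X) x
        = (S : Equiv.Perm X) ((T : Equiv.Perm X) ((S : Equiv.Perm X).symm x)) := rfl
    rw [h1, hx, Equiv.apply_symm_apply]

/-- The group `Aut(X, μ)` of automorphisms of the measure space: invertible measure preserving
transformations, two of them being identified when they coincide almost everywhere. -/
abbrev MeasureAut {X : Type*} [MeasurableSpace X] (μ : Measure X) : Type _ :=
  mpGroup μ ⧸ aeTrivial μ

namespace MeasureAut

variable {X : Type*} [MeasurableSpace X] {μ : Measure X}

/-- The image `T A` of a set under an automorphism. It is computed with a chosen representative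
of `T`, hence is meaningful up to a null set; see `image_mk`. -/
noncomputable def image (T : MeasureAut μ) (A : Set X) : Set X :=
  ((Quotient.out T : mpGroup μ) : Equiv.Perm X) '' A

/-- Up to a null set, `image` may be computed with any representative. -/
theorem image_mk (S : mpGroup μ) (A : Set X) :
    image (QuotientGroup.mk S : MeasureAut μ) A =ᵐ[μ] (S : Equiv.Perm X) '' A := by
  obtain ⟨N, hN⟩ := QuotientGroup.mk_out_eq_mul (aeTrivial μ) S
  have hN' : ∀ᵐ x ∂μ, ((N⁻¹ : aeTrivial μ) : mpGroup μ).1 x = x := (N⁻¹).2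
  have h := S.2.2.quasiMeasurePreserving.ae hN'
  have e : image (QuotientGroup.mk S : MeasureAut μ) A
      = ((S * N : mpGroup μ) : Equiv.Perm X) '' A := by
    rw [← hN]; rfl
  rw [e]
  filter_upwards [h] with x hx
  have hx' : ((N : mpGroup μ) : Equiv.Perm X).symm ((S : Equiv.Perm X).symm x)
      = (S : Equiv.Perm X).symm x := hx
  apply propext
  change x ∈ ((S * N : mpGroup μ) : Equiv.Perm X) '' A ↔ x ∈ (S : Equiv.Perm X) '' A
  rw [Equiv.image_eq_preimage_symm, Equiv.image_eq_preimage_symm]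
  change ((N : mpGroup μ) : Equiv.Perm X).symm ((S : Equiv.Perm X).symm x) ∈ A ↔
    (S : Equiv.Perm X).symm x ∈ A
  rw [hx']

/-- `T` is asymmetric if it is not conjugate to its inverse in `Aut(X, μ)`. -/
def IsAsymmetric (T : MeasureAut μ) : Prop := ¬ IsConj T T⁻¹

/-- The asymmetric double limit property: for some `m i, n i → ∞` and all measurable `A`,
`μ(A ∩ T^{m i} A ∩ T^{n i} A) → (μ(A) + 2 μ(A)^3) / 3` and
`μ(A ∩ T^{-m i} A ∩ T^{-n i} A) → μ(A)^2`. -/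
def HasAsymmetricLimits (T : MeasureAut μ) : Prop :=
  ∃ m n : ℕ → ℕ, Tendsto m atTop atTop ∧ Tendsto n atTop atTop ∧
    ∀ A : Set X, MeasurableSet A →
      Tendsto (fun i => μ.real (A ∩ image (T ^ (m i : ℤ)) A ∩ image (T ^ (n i : ℤ)) A)) atTop
        (𝓝 ((μ.real A + 2 * μ.real A ^ 3) / 3)) ∧
      Tendsto (fun i => μ.real (A ∩ image (T ^ (-(m i : ℤ))) A ∩ image (T ^ (-(n i : ℤ))) A)) atTop
        (𝓝 (μ.real A ^ 2))

end MeasureAut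

/-- The sequence of measurable sets `A i` is dense in the sigma-algebra of `X` with respect to
the distance `μ(A ∆ B)`. -/
def IsDenseSetSeq {X : Type*} [MeasurableSpace X] (μ : Measure X) (A : ℕ → Set X) : Prop :=
  (∀ i, MeasurableSet (A i)) ∧
    ∀ B : Set X, MeasurableSet B → ∀ ε : ℝ, 0 < ε → ∃ i, μ.real (A i ∆ B) < ε

namespace MeasureAut

variable {X : Type*} [MeasurableSpace X] {μ : Measure X}

/-- The `i`-th term `μ(S A_i ∆ T A_i) + μ(S⁻¹ A_i ∆ T⁻¹ A_i)` of the Halmos metric. -/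
noncomputable def halmosTerm (A : ℕ → Set X) (S T : MeasureAut μ) (i : ℕ) : ℝ :=
  μ.real (image S (A i) ∆ image T (A i)) + μ.real (image S⁻¹ (A i) ∆ image T⁻¹ (A i))

/-- The Halmos metric of a sequence of sets, with the weights `2^{-i}` that make the series
converge. -/
noncomputable def halmosDist (A : ℕ → Set X) (S T : MeasureAut μ) : ℝ :=
  ∑' i : ℕ, (1 / 2 : ℝ) ^ i * halmosTerm A S T i

theorem halmosTerm_nonneg (A : ℕ → Set X) (S T : MeasureAut μ) (i : ℕ) :
    0 ≤ halmosTerm A S T i := add_nonneg measureReal_nonneg measureReal_nonneg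

theorem summable_halmos [IsProbabilityMeasure μ] (A : ℕ → Set X) (S T : MeasureAut μ) :
    Summable fun i : ℕ => (1 / 2 : ℝ) ^ i * halmosTerm A S T i := by
  refine Summable.of_nonneg_of_le
    (fun i => mul_nonneg (by positivity) (halmosTerm_nonneg A S T i)) (fun i => ?_)
    (summable_geometric_two.mul_right 2)
  refine mul_le_mul_of_nonneg_left ?_ (by positivity)
  have h1 : μ.real (image S (A i) ∆ image T (A i)) ≤ 1 := measureReal_le_one
  have h2 : μ.real (image S⁻¹ (A i) ∆ image T⁻¹ (A i)) ≤ 1 := measureReal_le_one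
  unfold halmosTerm
  linarith

theorem measurableSet_image (T : MeasureAut μ) {A : Set X} (hA : MeasurableSet A) :
    MeasurableSet (image T A) := by
  unfold image
  rw [Equiv.image_eq_preimage_symm]
  exact (Quotient.out T : mpGroup μ).2.2.measurable hA

/-- `Aut(X, μ)` with the Halmos metric (it separates points when `X` is standard Borel and
the sequence is dense). -/
@[reducible]
noncomputable def halmosPseudoMetric (μ : Measure X) [IsProbabilityMeasure μ] (A : ℕ → Set X) :
    PseudoMetricSpace (MeasureAut μ) where
  dist := halmosDist A
  dist_self S := by simp [halmosDist, halmosTerm]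
  dist_comm S T := by
    simp only [halmosDist, halmosTerm, symmDiff_comm]
  dist_triangle S T U := by
    unfold halmosDist
    rw [← (summable_halmos A S T).tsum_add (summable_halmos A T U)]
    refine (summable_halmos A S U).tsum_le_tsum (fun i => ?_)
      ((summable_halmos A S T).add (summable_halmos A T U))
    rw [← mul_add]
    refine mul_le_mul_of_nonneg_left ?_ (by positivity)
    have h1 := measureReal_symmDiff_le (μ := μ) (s := image S (A i)) (t := image T (A i))
      (image U (A i))
    have h2 := measureReal_symmDiff_le (μ := μ) (s := image S⁻¹ (A i)) (t := image T⁻¹ (A i))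
      (image U⁻¹ (A i))
    unfold halmosTerm
    linarith

/-- A set of automorphisms is typical (generic) if it contains a dense `G_δ` set of
`Aut(X, μ)` with the Halmos metric of the sequence `A`. -/
def IsTypical [IsProbabilityMeasure μ] (A : ℕ → Set X) (P : Set (MeasureAut μ)) : Prop :=
  letI := halmosPseudoMetric μ A
  ∃ W : Set (MeasureAut μ), IsGδ W ∧ Dense W ∧ W ⊆ P

end MeasureAut

/-! ### Isomorphisms between nonatomic standard Borel probability spaces -/

section NonatomicIsomorphism

open Set ProbabilityTheory

/-! Asymmetry. If `c` conjugates `T` to its inverse, it carries the forward triple correlation of a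
set `B` to the backward one of `c B`, a set of the same measure. Property (*) then forces (x +
2x³)/3 = x² for every value x of the measure. The difference of the two sides is x(x - 1)(2x - 1)/3,
so a set of measure 1/3 gives a contradiction.

Typicality. `approxLimits μ A k` asks for the two limits up to 1/(k + 1), on the first k sets of the
dense sequence, at some times m, n ≥ k. These sets are open because triple correlations are
continuous, and an automorphism in all of them has property (*) because correlations and limit
values are Lipschitz in the set. The Halmos metric is complete (`completeSpace_halmos`), so by
Baire's theorem only density remains.

Density (`exists_asymmetric_near`). Given S, take four independent points of X and a cycle of twelve
windows of length L + 1. Window t displays the S-orbit segment of the point numbered `cls t`, and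
the map that advances the position displays S except at the ends of windows. Returning after one and
after five windows compares windows t, t - 1, t - 5, and the correlation is the average over t of
μ(A) to the number of distinct classes among them. The classes are the four translates {t, t - 1, t
- 5} with 3 ∣ t, which partition ℤ/12. Forwards one finds one class for a third of the t and three
for the rest, giving (μ(A) + 2μ(A)³)/3; backwards always two, giving μ(A)².

The cyclic map lives on another space, and the display map to X is only a factor map. Since both
spaces are nonatomic, some isomorphism matches any prescribed finite family of sets with its lift
(`exists_measurableEquiv_preimage_ae_eq`). Transporting the cyclic map by it gives an automorphism
of X that is close to S on the sets of interest and has the required correlations. -/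

theorem not_countable_of_nullSingletonClass {X : Type*} [MeasurableSpace X] (μ : Measure X)
    [IsProbabilityMeasure μ] [NullSingletonClass μ] : ¬ Countable X := by
  intro h
  have h0 := (Set.countable_univ (α := X)).measure_zero μ
  simp at h0

/-- The space is Borel isomorphic to the plane, which splits into uncountably many disjoint
uncountable lines; only countably many of them can have positive measure. Such a null set gives room
to complete a partial isomorphism to an everywhere defined one. -/
theorem exists_uncountable_null_set {X : Type*} [MeasurableSpace X] [StandardBorelSpace X]
    (hX : ¬ Countable X) (μ : Measure X) [SFinite μ] :
    ∃ N : Set X, MeasurableSet N ∧ ¬ N.Countable ∧ μ N = 0 := by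
  have hR : ¬ Countable (ℝ × ℝ) := fun h => by
    have : Countable ℝ := (Prod.mk_right_injective (0 : ℝ)).countable
    exact not_countable (α := ℝ) this
  let e : X ≃ᵐ ℝ × ℝ := PolishSpace.measurableEquivOfNotCountable hX hR
  let F : ℝ → Set X := fun x => {z | (e z).1 = x}
  have hm : ∀ x, MeasurableSet (F x) := fun x =>
    (measurable_fst.comp e.measurable) (measurableSet_singleton x)
  have hd : Pairwise (Function.onFun Disjoint F) := by
    intro x y hxy
    refine Set.disjoint_left.2 fun z hz hz' => hxy ?_
    exact hz.symm.trans hz'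
  have hc := Measure.countable_meas_pos_of_disjoint_iUnion (μ := μ) hm hd
  obtain ⟨x, hx⟩ : ∃ x, ¬ 0 < μ (F x) := by
    by_contra! h
    have : {i | 0 < μ (F i)} = univ := Set.eq_univ_of_forall h
    rw [this] at hc
    exact not_countable (α := ℝ) (Set.countable_univ_iff.1 hc)
  refine ⟨F x, hm x, fun hcount => ?_, by simpa using hx⟩
  have hinj : Function.Injective fun y : ℝ => e.symm (x, y) := fun a b hab => by
    simpa using hab
  have himg : (fun y : ℝ => e.symm (x, y)) '' univ ⊆ F x := by
    rintro _ ⟨y, -, rfl⟩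
    simp [F]
  have := (hcount.mono himg)
  exact not_countable (α := ℝ)
    (Set.countable_univ_iff.1 (Set.countable_of_injective_of_countable_image hinj.injOn this))

/-- A measure preserving map that is injective on a conull set coincides almost everywhere with
a measurable equivalence. -/
theorem exists_measurableEquiv_ae_eq {X Y : Type*} [MeasurableSpace X] [StandardBorelSpace X]
    [MeasurableSpace Y] [StandardBorelSpace Y] {μ : Measure X} {ν : Measure Y}
    [IsProbabilityMeasure μ] [IsProbabilityMeasure ν] [NullSingletonClass μ]
    [NullSingletonClass ν] {T : X → Y} (hT : MeasurePreserving T μ ν) {s : Set X}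
    (hs : MeasurableSet s) (hsμ : μ sᶜ = 0) (hinj : InjOn T s) :
    ∃ θ : X ≃ᵐ Y, MeasurePreserving θ μ ν ∧ ∀ᵐ x ∂μ, θ x = T x := by
  classical
  obtain ⟨N, hNm, hNc, hN0⟩ :=
    exists_uncountable_null_set (not_countable_of_nullSingletonClass μ) μ
  obtain ⟨M, hMm, hMc, hM0⟩ :=
    exists_uncountable_null_set (not_countable_of_nullSingletonClass ν) ν
  -- Discarding N and the preimage of M leaves uncountable complements both of s' and of its image,
  -- so the two complements are Borel isomorphic.
  let s' : Set X := (s \ N) \ T ⁻¹' M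
  have hs' : MeasurableSet s' := (hs.diff hNm).diff (hT.measurable hMm)
  have hs'inj : InjOn T s' := hinj.mono fun x hx => hx.1.1
  have hs'c : μ s'ᶜ = 0 := by
    have hsub : s'ᶜ ⊆ sᶜ ∪ N ∪ T ⁻¹' M := by
      intro x hx
      simp only [s', mem_compl_iff, Set.mem_sdiff, mem_union] at hx ⊢
      tauto
    refine measure_mono_null hsub ?_
    rw [measure_union_null_iff, measure_union_null_iff]
    exact ⟨⟨hsμ, hN0⟩, by rw [hT.measure_preimage hMm.nullMeasurableSet, hM0]⟩
  have := hs'.standardBorel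
  have hemb : MeasurableEmbedding (fun x : s' => T x) :=
    (hT.measurable.comp measurable_subtype_coe).measurableEmbedding
      ((injOn_iff_injective).1 hs'inj)
  have ht := hemb.measurableSet_range
  have hNs : N ⊆ s'ᶜ := fun x hx hx' => hx'.1.2 hx
  have hsc : ¬ Countable (s'ᶜ : Set X) := fun h =>
    hNc ((Set.countable_coe_iff.1 h).mono hNs)
  have htc : ¬ Countable ((range fun x : s' => T x)ᶜ : Set Y) := fun h => by
    refine hMc (Set.Countable.mono ?_ (Set.countable_coe_iff.1 h))
    rintro y hy ⟨⟨x, hx⟩, rfl⟩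
    exact hx.2 hy
  have := hs'.compl.standardBorel
  have := ht.compl.standardBorel
  let e2 : (s'ᶜ : Set X) ≃ᵐ ((range fun x : s' => T x)ᶜ : Set Y) :=
    PolishSpace.measurableEquivOfNotCountable hsc htc
  let θ : X ≃ᵐ Y := (MeasurableEquiv.sumCompl hs').symm.trans
    ((MeasurableEquiv.sumCongr hemb.equivRange e2).trans (MeasurableEquiv.sumCompl ht))
  have hθ : ∀ᵐ x ∂μ, θ x = T x := by
    have : ∀ᵐ x ∂μ, x ∈ s' := hs'c
    filter_upwards [this] with x hx
    have h1 : (MeasurableEquiv.sumCompl hs').symm x = Sum.inl ⟨x, hx⟩ :=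
      Equiv.Set.sumCompl_symm_apply_of_mem hx
    change (MeasurableEquiv.sumCompl ht) ((MeasurableEquiv.sumCongr hemb.equivRange e2)
      ((MeasurableEquiv.sumCompl hs').symm x)) = T x
    rw [h1]
    change ((hemb.equivRange ⟨x, hx⟩ : range fun x : s' => T x) : Y) = T x
    rw [hemb.equivRange_apply]
  exact ⟨θ, ⟨θ.measurable, by rw [Measure.map_congr hθ, hT.map_eq]⟩, hθ⟩

theorem continuous_cdf (m : Measure ℝ) [IsProbabilityMeasure m] [NullSingletonClass m] :
    Continuous (cdf m) := by
  rw [continuous_iff_continuousAt]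
  intro x
  have h := (cdf m).measure_singleton x
  rw [measure_cdf, measure_singleton] at h
  rw [(monotone_cdf m).continuousAt_iff_leftLim_eq_rightLim]
  have h2 : Function.leftLim (cdf m) x ≤ cdf m x := (monotone_cdf m).leftLim_le le_rfl
  have h3 := ENNReal.ofReal_eq_zero.1 h.symm
  rw [StieltjesFunction.rightLim_eq]
  linarith

/-- Continuity of F = `cdf m` makes every value in (0, 1) attained. Hence for 0 < y < 1 the set {F ≤
y} contains a half-line of measure y and lies in half-lines of measure z for all z in (y, 1). -/
theorem map_cdf (m : Measure ℝ) [IsProbabilityMeasure m] [NullSingletonClass m] :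
    m.map (cdf m) = volume.restrict (Icc 0 1) := by
  have hc := continuous_cdf m
  have := Measure.isProbabilityMeasure_map (μ := m) hc.measurable.aemeasurable
  refine Measure.ext_of_Iic _ _ fun y => ?_
  rw [Measure.map_apply hc.measurable measurableSet_Iic, Measure.restrict_apply measurableSet_Iic]
  rcases lt_or_ge y 0 with hy | hy
  · have h1 : cdf m ⁻¹' Iic y = ∅ := by
      ext x
      have := cdf_nonneg m x
      simp only [mem_preimage, mem_Iic, mem_empty_iff_false, iff_false, not_le]
      linarith
    have h2 : Iic y ∩ Icc (0 : ℝ) 1 = ∅ := by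
      ext x
      simp only [mem_inter_iff, mem_Iic, mem_Icc, mem_empty_iff_false, iff_false]
      intro h
      linarith [h.1, h.2.1]
    rw [h1, h2, measure_empty, measure_empty]
  rcases le_or_gt 1 y with hy1 | hy1
  · have h1 : cdf m ⁻¹' Iic y = univ := by
      ext x
      have := cdf_le_one m x
      simp only [mem_preimage, mem_Iic, mem_univ, iff_true]
      linarith
    have h2 : Iic y ∩ Icc (0 : ℝ) 1 = Icc 0 1 := by
      refine inter_eq_right.2 fun x hx => ?_
      exact hx.2.trans hy1
    rw [h1, h2, measure_univ, Real.volume_Icc]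
    simp
  have h2 : Iic y ∩ Icc (0 : ℝ) 1 = Icc 0 y := by
    ext x
    simp only [mem_inter_iff, mem_Iic, mem_Icc]
    constructor
    · rintro ⟨h1, h2, h3⟩
      exact ⟨h2, h1⟩
    · rintro ⟨h1, h2⟩
      exact ⟨h2, h1, by linarith⟩
  rw [h2, Real.volume_Icc, sub_zero]
  have hex : ∀ z, 0 < z → z < 1 → ∃ x, cdf m x = z := fun z hz hz1 =>
    mem_range_of_exists_le_of_exists_ge hc
      (((tendsto_cdf_atBot m).eventually_lt_const hz).exists.imp fun _ h => h.le)
      (((tendsto_cdf_atTop m).eventually_const_lt hz1).exists.imp fun _ h => h.le)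
  refine le_antisymm ?_ ?_
  · refine le_of_forall_gt_imp_ge_of_dense fun c hc' => ?_
    obtain ⟨z, hz, hzc⟩ : ∃ z : ℝ, (y < z ∧ z < 1) ∧ ENNReal.ofReal z ≤ c := by
      rcases eq_or_ne c ⊤ with rfl | hct
      · obtain ⟨z, hz⟩ := exists_between hy1
        exact ⟨z, hz, le_top⟩
      · have hyc : y < c.toReal := (ENNReal.ofReal_lt_iff_lt_toReal hy hct).1 hc'
        obtain ⟨z, hz⟩ := exists_between (lt_min hyc hy1)
        exact ⟨z, ⟨hz.1, hz.2.trans_le (min_le_right _ _)⟩,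
          ENNReal.ofReal_le_of_le_toReal (hz.2.le.trans (min_le_left _ _))⟩
    obtain ⟨x, hx⟩ := hex z (hy.trans_lt hz.1) hz.2
    refine le_trans (measure_mono (t := Iic x) fun w hw => ?_) ?_
    · by_contra hwx
      have := monotone_cdf m (not_le.1 hwx).le
      have hw' : cdf m w ≤ y := hw
      linarith [hz.1]
    · rw [← ofReal_cdf, hx]
      exact hzc
  · rcases hy.eq_or_lt with rfl | hy0
    · simp
    obtain ⟨x, hx⟩ := hex y hy0 hy1
    rw [← hx, ofReal_cdf]
    exact measure_mono fun w hw => monotone_cdf m hw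

/-- A value taken twice by a monotone function is taken on a whole interval, and the intervals of
different values are disjoint, so there are countably many such values. -/
theorem exists_countable_injOn_compl {F : ℝ → ℝ} (hF : Monotone F) :
    ∃ J : Set ℝ, J.Countable ∧ InjOn F (F ⁻¹' J)ᶜ := by
  let J : Set ℝ := {y | ∃ a b, a < b ∧ F a = y ∧ F b = y}
  refine ⟨J, ?_, ?_⟩
  · choose! a b hab ha hb using fun y (hy : y ∈ J) => (hy : ∃ a b, a < b ∧ F a = y ∧ F b = y)
    have hinj : InjOn a J := fun y hy z hz h => by rw [← ha y hy, h, ha z hz]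
    have : (a '' J).Countable := by
      refine Set.PairwiseDisjoint.countable_of_Ioo (y := fun x => b (F x)) ?_ ?_
      · rintro _ ⟨y, hy, rfl⟩ _ ⟨z, hz, rfl⟩ hne
        refine Set.disjoint_left.2 fun w hw hw' => hne ?_
        simp only [ha y hy, ha z hz] at hw hw'
        have h1 : F w = y := le_antisymm ((hF hw.2.le).trans (hb y hy).le)
          ((ha y hy).ge.trans (hF hw.1.le))
        have h2 : F w = z := le_antisymm ((hF hw'.2.le).trans (hb z hz).le)
          ((ha z hz).ge.trans (hF hw'.1.le))
        rw [← h1, ← h2]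
      · rintro _ ⟨y, hy, rfl⟩
        simp only [ha y hy]
        exact hab y hy
    exact Set.countable_of_injective_of_countable_image hinj this
  · intro x hx y hy hxy
    by_contra hne
    rcases lt_or_gt_of_ne hne with h | h
    · exact hx ⟨x, y, h, rfl, hxy.symm⟩
    · exact hy ⟨y, x, h, rfl, hxy⟩

instance isProbabilityMeasure_restrict_Icc :
    IsProbabilityMeasure (volume.restrict (Icc (0 : ℝ) 1)) := ⟨by simp⟩

/-- The distribution function of an injective function on a nonatomic space is almost everywhere
equal to an isomorphism with the unit interval. -/
theorem exists_measurableEquiv_ae_eq_cdf {X : Type*} [MeasurableSpace X] [StandardBorelSpace X]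
    (μ : Measure X) [IsProbabilityMeasure μ] [NullSingletonClass μ] {φ : X → ℝ}
    (hφ : Measurable φ) (hinj : Function.Injective φ) :
    ∃ θ : X ≃ᵐ ℝ, MeasurePreserving θ μ (volume.restrict (Icc 0 1)) ∧
      ∀ᵐ x ∂μ, θ x = cdf (μ.map φ) (φ x) := by
  have := Measure.isProbabilityMeasure_map (μ := μ) hφ.aemeasurable
  have : NullSingletonClass (μ.map φ) := ⟨fun y => by
    rw [Measure.map_apply hφ (measurableSet_singleton y)]
    exact (Set.subsingleton_singleton.preimage hinj).measure_zero μ⟩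
  have hFm : Measurable (cdf (μ.map φ)) := (monotone_cdf _).measurable
  have hmp : MeasurePreserving (fun x => cdf (μ.map φ) (φ x)) μ (volume.restrict (Icc 0 1)) :=
    ⟨hFm.comp hφ, by rw [← map_cdf (μ.map φ), Measure.map_map hFm hφ]; rfl⟩
  obtain ⟨J, hJ, hJinj⟩ := exists_countable_injOn_compl (monotone_cdf (μ.map φ))
  refine exists_measurableEquiv_ae_eq hmp
    (s := ((fun x => cdf (μ.map φ) (φ x)) ⁻¹' J)ᶜ)
    (hmp.measurable hJ.measurableSet).compl ?_ ?_
  · rw [compl_compl, hmp.measure_preimage hJ.measurableSet.nullMeasurableSet, hJ.measure_zero]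
  · exact fun x hx y hy hxy => hinj (hJinj hx hy hxy)

theorem exists_measureReal_eq {X : Type*} [MeasurableSpace X] [StandardBorelSpace X]
    (μ : Measure X) [IsProbabilityMeasure μ] [NullSingletonClass μ] {c : ℝ} (h0 : 0 ≤ c)
    (h1 : c ≤ 1) : ∃ s : Set X, MeasurableSet s ∧ μ.real s = c := by
  obtain ⟨θ, hθ, -⟩ := exists_measurableEquiv_ae_eq_cdf μ
    (measurableEmbedding_embeddingReal X).measurable (measurableEmbedding_embeddingReal X).injective
  refine ⟨θ ⁻¹' Icc 0 c, θ.measurable measurableSet_Icc, ?_⟩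
  rw [measureReal_def, hθ.measure_preimage measurableSet_Icc.nullMeasurableSet,
    Measure.restrict_apply measurableSet_Icc, inter_eq_left.2 (Icc_subset_Icc_right h1),
    Real.volume_Icc, sub_zero, ENNReal.toReal_ofReal h0]

/-- An injective measurable function on a standard Borel space with values in `(n, n + 1)` on the
level set `{g = n}`. -/
noncomputable def labelledEmbedding {X : Type*} [MeasurableSpace X] [StandardBorelSpace X]
    (g : X → ℕ) (x : X) : ℝ := g x + Real.sigmoid (embeddingReal X x)

theorem measurable_labelledEmbedding {X : Type*} [MeasurableSpace X] [StandardBorelSpace X]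
    {g : X → ℕ} (hg : Measurable g) : Measurable (labelledEmbedding g) :=
  (measurable_from_top.comp hg).add
    (Real.sigmoid_strictMono.monotone.measurable.comp
      (measurableEmbedding_embeddingReal X).measurable)

theorem labelledEmbedding_le_natCast_iff {X : Type*} [MeasurableSpace X] [StandardBorelSpace X]
    (g : X → ℕ) (x : X) (n : ℕ) : labelledEmbedding g x ≤ n ↔ g x < n := by
  have h0 := Real.sigmoid_pos (embeddingReal X x)
  have h1 := Real.sigmoid_lt_one (embeddingReal X x)
  unfold labelledEmbedding
  constructor
  · intro h
    exact_mod_cast (by linarith : (g x : ℝ) < n)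
  · intro h
    have : (g x : ℝ) + 1 ≤ n := by exact_mod_cast h
    linarith

theorem labelledEmbedding_injective {X : Type*} [MeasurableSpace X] [StandardBorelSpace X]
    (g : X → ℕ) : Function.Injective (labelledEmbedding g) := by
  intro x y hxy
  have hg : g x = g y := by
    refine eq_of_forall_gt_iff fun n => ?_
    rw [← labelledEmbedding_le_natCast_iff, ← labelledEmbedding_le_natCast_iff, hxy]
  refine (measurableEmbedding_embeddingReal X).injective (Real.sigmoid_strictMono.injective ?_)
  unfold labelledEmbedding at hxy
  rw [hg] at hxy
  exact add_left_cancel hxy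

theorem cdf_map_labelledEmbedding {X : Type*} [MeasurableSpace X] [StandardBorelSpace X]
    (μ : Measure X) [IsProbabilityMeasure μ] {g : X → ℕ} (hg : Measurable g) (n : ℕ) :
    cdf (μ.map (labelledEmbedding g)) n = (μ.map g).real (Iio n) := by
  have := Measure.isProbabilityMeasure_map (μ := μ) (measurable_labelledEmbedding hg).aemeasurable
  rw [cdf_eq_real, map_measureReal_apply (measurable_labelledEmbedding hg) measurableSet_Iic,
    map_measureReal_apply hg measurableSet_Iio]
  congr 1
  ext x
  exact labelledEmbedding_le_natCast_iff g x n

/-- The level sets of g are sent to consecutive intervals of [0, 1], whose cut points μ(g < n)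
depend only on the distribution of g. -/
theorem cdf_map_labelledEmbedding_bounds {X : Type*} [MeasurableSpace X] [StandardBorelSpace X]
    (μ : Measure X) [IsProbabilityMeasure μ] {g : X → ℕ} (hg : Measurable g) (x : X) (n : ℕ) :
    (g x < n → cdf (μ.map (labelledEmbedding g)) (labelledEmbedding g x) ≤
      (μ.map g).real (Iio n)) ∧
    (n ≤ g x → (μ.map g).real (Iio n) ≤
      cdf (μ.map (labelledEmbedding g)) (labelledEmbedding g x)) := by
  rw [← cdf_map_labelledEmbedding μ hg]
  refine ⟨fun hn => monotone_cdf _ ((labelledEmbedding_le_natCast_iff g x n).2 hn),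
    fun hn => monotone_cdf _ (le_of_lt ?_)⟩
  rw [← not_le, labelledEmbedding_le_natCast_iff]
  exact hn.not_gt

/-- Functions with the same countable distribution on two nonatomic spaces correspond to each
other under some isomorphism. -/
theorem exists_measurableEquiv_comp_ae_eq {X Y : Type*} [MeasurableSpace X]
    [StandardBorelSpace X] [MeasurableSpace Y] [StandardBorelSpace Y] {μ : Measure X}
    {ν : Measure Y} [IsProbabilityMeasure μ] [IsProbabilityMeasure ν] [NullSingletonClass μ]
    [NullSingletonClass ν] {g : X → ℕ} {h : Y → ℕ} (hg : Measurable g) (hh : Measurable h)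
    (hgh : μ.map g = ν.map h) :
    ∃ θ : X ≃ᵐ Y, MeasurePreserving θ μ ν ∧ ∀ᵐ x ∂μ, h (θ x) = g x := by
  obtain ⟨α, hα, hα'⟩ := exists_measurableEquiv_ae_eq_cdf μ (measurable_labelledEmbedding hg)
    (labelledEmbedding_injective g)
  obtain ⟨β, hβ, hβ'⟩ := exists_measurableEquiv_ae_eq_cdf ν (measurable_labelledEmbedding hh)
    (labelledEmbedding_injective h)
  have hθ : MeasurePreserving (α.trans β.symm) μ ν := (hβ.symm β).comp hα
  refine ⟨α.trans β.symm, hθ, ?_⟩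
  -- The cut points between level sets form a null set. Since α x = β (θ x) almost everywhere,
  -- different labels for x and θ x would make this number both at most and at least some cut point,
  -- hence equal to it.
  let C : Set ℝ := range fun n : ℕ => (μ.map g).real (Iio n)
  have hC : C.Countable := countable_range _
  have hαC : ∀ᵐ x ∂μ, α x ∉ C :=
    hα.quasiMeasurePreserving.ae (hC.ae_notMem _)
  filter_upwards [hα', hθ.quasiMeasurePreserving.ae hβ', hαC] with x hx hy hxC
  change β ((β.symm) (α x)) = _ at hy
  rw [β.apply_symm_apply] at hy
  have hC' : ∀ n : ℕ, (μ.map g).real (Iio n) ≠ α x := fun n hn => hxC ⟨n, hn⟩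
  rcases lt_trichotomy (h ((α.trans β.symm) x)) (g x) with hlt | heq | hlt
  · refine absurd (le_antisymm ?_ ?_) (hC' (g x))
    · rw [hx]
      exact (cdf_map_labelledEmbedding_bounds μ hg x (g x)).2 le_rfl
    · rw [hy, hgh]
      exact (cdf_map_labelledEmbedding_bounds ν hh _ (g x)).1 hlt
  · exact heq
  · refine absurd (le_antisymm ?_ ?_) (hC' (h ((α.trans β.symm) x)))
    · rw [hy, hgh]
      exact (cdf_map_labelledEmbedding_bounds ν hh _ _).2 le_rfl
    · rw [hx]
      exact (cdf_map_labelledEmbedding_bounds μ hg x _).1 hlt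

end NonatomicIsomorphism

/-! ### Limits of measure preserving maps on the measure algebra -/

section LimitOfMaps

theorem measureReal_symmDiff_congr {X : Type*} [MeasurableSpace X] {μ : Measure X}
    {A A' B B' : Set X} (hA : A =ᵐ[μ] A') (hB : B =ᵐ[μ] B') :
    μ.real (A ∆ B) = μ.real (A' ∆ B') := by
  refine measureReal_congr ?_
  filter_upwards [hA, hB] with x hxA hxB
  have h1 : x ∈ A ↔ x ∈ A' := iff_of_eq hxA
  have h2 : x ∈ B ↔ x ∈ B' := iff_of_eq hxB
  refine propext ?_
  change x ∈ A ∆ B ↔ x ∈ A' ∆ B'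
  rw [Set.mem_symmDiff, Set.mem_symmDiff, h1, h2]

theorem measureReal_symmDiff_preimage {X Y : Type*} [MeasurableSpace X] [MeasurableSpace Y]
    {μ : Measure X} {ν : Measure Y} {T : X → Y} (hT : MeasurePreserving T μ ν) {A B : Set Y}
    (hA : MeasurableSet A) (hB : MeasurableSet B) :
    μ.real ((T ⁻¹' A) ∆ (T ⁻¹' B)) = ν.real (A ∆ B) := by
  rw [← Set.preimage_symmDiff, measureReal_def,
    hT.measure_preimage (hA.symmDiff hB).nullMeasurableSet, measureReal_def]

theorem ae_eq_of_measureReal_symmDiff_eq_zero {X : Type*} [MeasurableSpace X] {μ : Measure X}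
    [IsFiniteMeasure μ] {A B : Set X} (h : μ.real (A ∆ B) = 0) : A =ᵐ[μ] B :=
  measure_symmDiff_eq_zero_iff.1 ((measureReal_eq_zero_iff).1 h)

/-- A sequence of measure preserving maps whose preimages of measurable sets are Cauchy has a
limit. -/
theorem exists_limit_of_cauchy_preimage {X : Type*} [MeasurableSpace X] [StandardBorelSpace X]
    {μ : Measure X} [IsProbabilityMeasure μ] {A : ℕ → Set X} (hA : IsDenseSetSeq μ A)
    {V : ℕ → X → X} (hV : ∀ n, MeasurePreserving (V n) μ μ)
    (hC : ∀ C, MeasurableSet C → ∀ ε : ℝ, 0 < ε → ∃ N, ∀ n ≥ N, ∀ m ≥ N,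
      μ.real ((V n ⁻¹' C) ∆ (V m ⁻¹' C)) < ε) :
    ∃ T : X → X, MeasurePreserving T μ μ ∧ ∀ C, MeasurableSet C →
      Tendsto (fun n => μ.real ((V n ⁻¹' C) ∆ (T ⁻¹' C))) atTop (𝓝 0) := by
  classical
  have : Nonempty X := by
    by_contra h
    have := not_nonempty_iff.1 h
    have h1 := measure_univ (μ := μ)
    rw [Set.eq_empty_of_isEmpty Set.univ, measure_empty] at h1
    exact zero_ne_one h1
  -- Two sequences are interleaved: the generating sets make the coding e injective, and the dense
  -- sets carry the convergence to arbitrary measurable sets at the end.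
  let C : ℕ → Set X := fun k =>
    Sum.elim A (MeasurableSpace.natGeneratingSequence X) (Equiv.natSumNatEquivNat.symm k)
  have hCA : ∀ i, C (Equiv.natSumNatEquivNat (Sum.inl i)) = A i := fun i => by simp [C]
  have hCg : ∀ i, C (Equiv.natSumNatEquivNat (Sum.inr i)) =
    MeasurableSpace.natGeneratingSequence X i := fun i => by simp [C]
  have hCm : ∀ k, MeasurableSet (C k) := fun k => by
    rcases h : Equiv.natSumNatEquivNat.symm k with i | i
    · simp only [C, h, Sum.elim_inl]
      exact hA.1 i
    · simp only [C, h, Sum.elim_inr]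
      exact MeasurableSpace.measurableSet_natGeneratingSequence i
  let e : X → ℕ → Bool := fun x k => decide (x ∈ C k)
  have heinj : Function.Injective e := by
    intro x y hxy
    refine MeasurableSpace.injective_mapNatBool X (funext fun i => ?_)
    have := congrFun hxy (Equiv.natSumNatEquivNat (Sum.inr i))
    simp only [e, hCg] at this
    exact this
  have hem : Measurable e := by
    refine measurable_pi_iff.2 fun k => measurable_to_bool ?_
    convert hCm k using 1
    ext x
    simp [e]
  have hee : MeasurableEmbedding e := hem.measurableEmbedding heinj
  -- Along this subsequence the N-th step changes the preimages of the first N + 1 sets by less than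
  -- 2^{-N}. By Borel–Cantelli each coordinate of the code of V (φ N) x is eventually constant for
  -- almost every x.
  obtain ⟨φ, hφ, hφC⟩ : ∃ φ : ℕ → ℕ, StrictMono φ ∧ ∀ N, ∀ n ≥ φ N, ∀ m ≥ φ N, ∀ k ≤ N,
      μ.real ((V n ⁻¹' C k) ∆ (V m ⁻¹' C k)) < (1 / 2 : ℝ) ^ N := by
    refine extraction_forall_of_eventually (P := fun N M => ∀ n ≥ M, ∀ m ≥ M, ∀ k ≤ N,
      μ.real ((V n ⁻¹' C k) ∆ (V m ⁻¹' C k)) < (1 / 2 : ℝ) ^ N) fun N => ?_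
    choose M hM using fun k => hC (C k) (hCm k) ((1 / 2 : ℝ) ^ N) (by positivity)
    filter_upwards [eventually_ge_atTop ((Finset.range (N + 1)).sup M)] with L hL n hn m hm k hk
    have hkL : M k ≤ L := (Finset.le_sup (Finset.mem_range.2 (by omega))).trans hL
    exact hM k n (hkL.trans hn) m (hkL.trans hm)
  have hconst : ∀ k, ∀ᵐ x ∂μ, ∃ b : Bool, ∀ᶠ N in atTop, e (V (φ N) x) k = b := by
    intro k
    have hsum : ∑' N, μ ((V (φ (N + k)) ⁻¹' C k) ∆ (V (φ (N + k + 1)) ⁻¹' C k)) ≠ ⊤ := by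
      refine ne_top_of_le_ne_top (b := ∑' N, ENNReal.ofReal ((1 / 2 : ℝ) ^ N)) ?_
        (ENNReal.tsum_le_tsum fun N => ?_)
      · rw [← ENNReal.ofReal_tsum_of_nonneg (fun _ => by positivity) summable_geometric_two]
        exact ENNReal.ofReal_ne_top
      · rw [← ofReal_measureReal]
        refine ENNReal.ofReal_le_ofReal ((hφC (N + k) _ le_rfl _ (hφ.monotone (by omega)) k
          (by omega)).le.trans (pow_le_pow_of_le_one (by norm_num) (by norm_num) (by omega)))
    filter_upwards [ae_eventually_notMem hsum] with x hx
    obtain ⟨M, hM⟩ := eventually_atTop.1 hx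
    refine ⟨e (V (φ (M + k)) x) k, eventually_atTop.2 ⟨M + k, fun N hN => ?_⟩⟩
    induction N, hN using Nat.le_induction with
    | base => rfl
    | succ N hN ih =>
      rw [← ih]
      have h := hM (N - k) (by omega)
      rw [Nat.sub_add_cancel (by omega : k ≤ N), Set.mem_symmDiff] at h
      simp only [e, Set.mem_preimage] at h ⊢
      refine decide_eq_decide.2 ?_
      tauto
  have hlim : ∀ᵐ x ∂μ, ∃ l, Tendsto (fun N => e (V (φ N) x)) atTop (𝓝 l) := by
    filter_upwards [ae_all_iff.2 hconst] with x hx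
    choose b hb using hx
    exact ⟨b, tendsto_pi_nhds.2 fun k =>
      tendsto_const_nhds.congr' ((hb k).mono fun _ h => h.symm)⟩
  obtain ⟨G, hGm, hG⟩ := measurable_limit_of_tendsto_metrizable_ae
    (fun N => (hem.comp (hV (φ N)).measurable).aemeasurable) hlim
  -- All e ∘ V (φ N) have the law of e, and dominated convergence passes it to the limit code G.
  -- Hence G takes values in the range of e almost everywhere and can be decoded by a left inverse r
  -- of e.
  have hGmap : μ.map G = μ.map e := by
    have := Measure.isProbabilityMeasure_map (μ := μ) hGm.aemeasurable
    have := Measure.isProbabilityMeasure_map (μ := μ) hem.aemeasurable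
    refine ext_of_forall_integral_eq_of_IsFiniteMeasure fun f => ?_
    have hfm : Measurable f := f.continuous.measurable
    rw [integral_map hGm.aemeasurable hfm.aestronglyMeasurable,
      integral_map hem.aemeasurable hfm.aestronglyMeasurable]
    have ht : Tendsto (fun N => ∫ x, f (e (V (φ N) x)) ∂μ) atTop (𝓝 (∫ x, f (G x) ∂μ)) := by
      refine tendsto_integral_of_dominated_convergence (fun _ => ‖f‖)
        (fun N => (hfm.comp (hem.comp (hV (φ N)).measurable)).aestronglyMeasurable)
        (integrable_const _) (fun N => Eventually.of_forall fun x => f.norm_coe_le_norm _) ?_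
      filter_upwards [hG] with x hx
      exact (f.continuous.tendsto _).comp hx
    refine tendsto_nhds_unique ht (tendsto_const_nhds.congr fun N => ?_)
    conv_lhs => rw [← (hV (φ N)).map_eq]
    exact integral_map (hV (φ N)).measurable.aemeasurable (hfm.comp hem).aestronglyMeasurable
  obtain ⟨r, hr, hre⟩ := hee.exists_measurable_extend measurable_id fun _ => ‹Nonempty X›
  have hTm : Measurable (r ∘ G) := hr.comp hGm
  have hT : MeasurePreserving (r ∘ G) μ μ := ⟨hTm, by
    rw [← Measure.map_map hr hGm, hGmap, Measure.map_map hr hem, hre, Measure.map_id]⟩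
  have heT : ∀ᵐ x ∂μ, e ((r ∘ G) x) = G x := by
    have h1 : ∀ᵐ y ∂(μ.map G), y ∈ Set.range e := by
      rw [hGmap]
      exact ae_map_mem_range e hee.measurableSet_range μ
    filter_upwards [ae_of_ae_map hGm.aemeasurable h1] with x hx
    obtain ⟨z, hz⟩ := hx
    have h2 : r (e z) = z := congrFun hre z
    rw [Function.comp_apply, ← hz, h2]
  refine ⟨r ∘ G, hT, ?_⟩
  have hk : ∀ k, Tendsto (fun n => μ.real ((V n ⁻¹' C k) ∆ ((r ∘ G) ⁻¹' C k))) atTop (𝓝 0) := by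
    intro k
    have hsub : Tendsto (fun N => μ.real ((V (φ N) ⁻¹' C k) ∆ ((r ∘ G) ⁻¹' C k))) atTop
        (𝓝 0) := by
      have h := tendsto_measure_of_ae_tendsto_indicator (μ := μ) atTop MeasurableSet.empty
        (As := fun N => (V (φ N) ⁻¹' C k) ∆ ((r ∘ G) ⁻¹' C k))
        (fun N => ((hV (φ N)).measurable (hCm k)).symmDiff (hTm (hCm k))) MeasurableSet.univ
        (measure_ne_top _ _) (Eventually.of_forall fun _ => Set.subset_univ _) ?_
      · rw [measure_empty] at h
        exact (ENNReal.tendsto_toReal ENNReal.zero_ne_top).comp h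
      · filter_upwards [hG, heT] with x hx hxT
        have hx' := (tendsto_pi_nhds.1 hx k).eventually (eventually_of_mem
          (mem_nhds_discrete.2 rfl : {G x k} ∈ 𝓝 (G x k)) fun _ h => h)
        filter_upwards [hx'] with N hN
        have hN' : e (V (φ N) x) k = e ((r ∘ G) x) k := by rw [hxT]; exact hN
        have := decide_eq_decide.1 hN'
        simp only [Set.mem_symmDiff, Set.mem_preimage, Set.mem_empty_iff_false, iff_false]
        tauto
    -- The Cauchy hypothesis extends the convergence from the subsequence to the full sequence.
    rw [Metric.tendsto_atTop] at hsub ⊢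
    intro ε hε
    obtain ⟨N₁, h₁⟩ := hsub (ε / 2) (half_pos hε)
    obtain ⟨N₂, h₂⟩ := hC (C k) (hCm k) (ε / 2) (half_pos hε)
    refine ⟨N₂, fun n hn => ?_⟩
    have h3 := h₁ (max N₁ N₂) (le_max_left _ _)
    have h4 := h₂ n hn (φ (max N₁ N₂)) ((le_max_right _ _).trans (hφ.id_le _))
    rw [Real.dist_0_eq_abs, abs_of_nonneg measureReal_nonneg] at h3 ⊢
    have h5 := measureReal_symmDiff_le (μ := μ) (s := V n ⁻¹' C k)
      (t := V (φ (max N₁ N₂)) ⁻¹' C k) ((r ∘ G) ⁻¹' C k)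
    linarith
  intro B hB
  rw [Metric.tendsto_atTop]
  intro ε hε
  obtain ⟨i, hi⟩ := hA.2 B hB (ε / 4) (by linarith)
  obtain ⟨N, hN⟩ := Metric.tendsto_atTop.1 (hk (Equiv.natSumNatEquivNat (Sum.inl i))) (ε / 2)
    (half_pos hε)
  refine ⟨N, fun n hn => ?_⟩
  have h1 := hN n hn
  rw [Real.dist_0_eq_abs, abs_of_nonneg measureReal_nonneg] at h1 ⊢
  rw [hCA] at h1
  have h2 := measureReal_symmDiff_le (μ := μ) (s := V n ⁻¹' B) (t := V n ⁻¹' A i)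
    ((r ∘ G) ⁻¹' B)
  have h3 := measureReal_symmDiff_le (μ := μ) (s := V n ⁻¹' A i) (t := (r ∘ G) ⁻¹' A i)
    ((r ∘ G) ⁻¹' B)
  rw [measureReal_symmDiff_preimage (hV n) hB (hA.1 i), symmDiff_comm B] at h2
  rw [measureReal_symmDiff_preimage hT (hA.1 i) hB] at h3
  linarith

end LimitOfMaps

/-! ### Action on the measure algebra and completeness of the Halmos metric -/

namespace MeasureAut

variable {X : Type*} [MeasurableSpace X] {μ : Measure X}

/-- A chosen representative of an automorphism. -/
noncomputable def rep (T : MeasureAut μ) : Equiv.Perm X := (Quotient.out T : mpGroup μ)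

theorem measurePreserving_rep (T : MeasureAut μ) : MeasurePreserving (rep T) μ μ :=
  (Quotient.out T : mpGroup μ).2.1

theorem measurePreserving_rep_symm (T : MeasureAut μ) : MeasurePreserving (rep T).symm μ μ :=
  (Quotient.out T : mpGroup μ).2.2

theorem image_eq_preimage (T : MeasureAut μ) (A : Set X) :
    image T A = (rep T).symm ⁻¹' A := Equiv.image_eq_preimage_symm _ _

theorem image_congr (T : MeasureAut μ) {A B : Set X} (h : A =ᵐ[μ] B) :
    image T A =ᵐ[μ] image T B := by
  rw [image_eq_preimage, image_eq_preimage]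
  exact (measurePreserving_rep_symm T).quasiMeasurePreserving.preimage_ae_eq h

theorem measureReal_image (T : MeasureAut μ) {A : Set X} (hA : MeasurableSet A) :
    μ.real (image T A) = μ.real A := by
  rw [image_eq_preimage, measureReal_def,
    (measurePreserving_rep_symm T).measure_preimage hA.nullMeasurableSet, measureReal_def]

theorem image_inter (T : MeasureAut μ) (A B : Set X) :
    image T (A ∩ B) = image T A ∩ image T B := by
  simp only [image_eq_preimage, Set.preimage_inter]

theorem measureReal_symmDiff_image (T : MeasureAut μ) {A B : Set X} (hA : MeasurableSet A)
    (hB : MeasurableSet B) : μ.real (image T A ∆ image T B) = μ.real (A ∆ B) := by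
  simp only [image_eq_preimage]
  exact measureReal_symmDiff_preimage (measurePreserving_rep_symm T) hA hB

theorem image_mul (S T : MeasureAut μ) (A : Set X) :
    image (S * T) A =ᵐ[μ] image S (image T A) := by
  have h : S * T = QuotientGroup.mk ((Quotient.out S : mpGroup μ) * (Quotient.out T : mpGroup μ)) := by
    rw [QuotientGroup.mk_mul]
    exact congrArg₂ _ (Quotient.out_eq' S).symm (Quotient.out_eq' T).symm
  have h2 := image_mk ((Quotient.out S : mpGroup μ) * (Quotient.out T : mpGroup μ)) A
  rw [← h] at h2
  refine h2.trans (Eventually.of_forall fun x => ?_)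
  unfold image
  rw [← Set.image_comp]
  rfl

theorem image_one (A : Set X) : image (1 : MeasureAut μ) A =ᵐ[μ] A := by
  have h := image_mk (1 : mpGroup μ) A
  rw [QuotientGroup.mk_one] at h
  refine h.trans (Eventually.of_forall fun x => ?_)
  change ((1 : Equiv.Perm X) '' A) x = A x
  rw [Equiv.Perm.coe_one, Set.image_id]

theorem image_inv_image (T : MeasureAut μ) (A : Set X) : image T⁻¹ (image T A) =ᵐ[μ] A := by
  have h := (image_mul T⁻¹ T A).symm
  rw [inv_mul_cancel] at h
  exact h.trans (image_one A)

theorem image_image_inv (T : MeasureAut μ) (A : Set X) : image T (image T⁻¹ A) =ᵐ[μ] A := by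
  simpa using image_inv_image T⁻¹ A

/-- The automorphism given by a measure preserving measurable equivalence. -/
def ofEquiv (θ : X ≃ᵐ X) (hθ : MeasurePreserving θ μ μ) : MeasureAut μ :=
  QuotientGroup.mk (⟨θ.toEquiv, hθ, hθ.symm θ⟩ : mpGroup μ)

theorem image_inv_ofEquiv (θ : X ≃ᵐ X) (hθ : MeasurePreserving θ μ μ) (A : Set X) :
    image (ofEquiv θ hθ)⁻¹ A =ᵐ[μ] θ ⁻¹' A := by
  refine (image_mk (⟨θ.toEquiv, hθ, hθ.symm θ⟩⁻¹ : mpGroup μ) A).trans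
    (Eventually.of_forall fun x => ?_)
  change (θ.toEquiv.symm '' A) x = (θ ⁻¹' A) x
  rw [Equiv.image_eq_preimage_symm]
  rfl

theorem tendsto_halmosDist_of_halmosTerm [IsProbabilityMeasure μ] {A : ℕ → Set X} {ι : Type*}
    {u : ι → MeasureAut μ} {l : Filter ι} {S : MeasureAut μ}
    (h : ∀ i, Tendsto (fun j => halmosTerm A (u j) S i) l (𝓝 0)) :
    Tendsto (fun j => halmosDist A (u j) S) l (𝓝 0) := by
  have h0 : (0 : ℝ) = ∑' i : ℕ, (1 / 2 : ℝ) ^ i * 0 := by simp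
  unfold halmosDist
  rw [h0]
  refine tendsto_tsum_of_dominated_convergence (summable_geometric_two.mul_right 2)
    (fun k => (h k).const_mul _) (Eventually.of_forall fun i k => ?_)
  have h1 : μ.real (image (u i) (A k) ∆ image S (A k)) ≤ 1 := measureReal_le_one
  have h2 : μ.real (image (u i)⁻¹ (A k) ∆ image S⁻¹ (A k)) ≤ 1 := measureReal_le_one
  rw [Real.norm_of_nonneg (mul_nonneg (by positivity) (halmosTerm_nonneg A _ _ k))]
  refine mul_le_mul_of_nonneg_left ?_ (by positivity)
  unfold halmosTerm
  linarith

/-- Pointwise convergence of automorphisms on the measure algebra. -/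
def ImageTendsto {ι : Type*} (u : ι → MeasureAut μ) (l : Filter ι) (S : MeasureAut μ) : Prop :=
  ∀ B, MeasurableSet B → Tendsto (fun i => μ.real (image (u i) B ∆ image S B)) l (𝓝 0)

namespace ImageTendsto

variable {ι : Type*} {u v : ι → MeasureAut μ} {l : Filter ι} {S T : MeasureAut μ}

/-- Applying the automorphism u i turns u⁻¹B ∆ S⁻¹B into B ∆ u(S⁻¹B), where B = S(S⁻¹B); so the
hypothesis is used on the fixed set S⁻¹B. -/
theorem inv (h : ImageTendsto u l S) : ImageTendsto (fun i => (u i)⁻¹) l S⁻¹ := by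
  intro B hB
  refine (h _ (measurableSet_image S⁻¹ hB)).congr fun i => ?_
  rw [← measureReal_symmDiff_image (u i) (measurableSet_image (u i)⁻¹ hB)
    (measurableSet_image S⁻¹ hB), symmDiff_comm]
  exact measureReal_symmDiff_congr ((image_image_inv S B).trans (image_image_inv (u i) B).symm)
    ae_eq_rfl

theorem mul [IsFiniteMeasure μ] (hu : ImageTendsto u l S) (hv : ImageTendsto v l T) :
    ImageTendsto (fun i => u i * v i) l (S * T) := by
  intro B hB
  have h := (hv B hB).add (hu _ (measurableSet_image T hB))
  rw [add_zero] at h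
  refine squeeze_zero (fun _ => measureReal_nonneg) (fun i => ?_) h
  rw [measureReal_symmDiff_congr (image_mul (u i) (v i) B) (image_mul S T B),
    ← measureReal_symmDiff_image (u i) (measurableSet_image (v i) hB) (measurableSet_image T hB)]
  exact measureReal_symmDiff_le _

theorem pow [IsFiniteMeasure μ] (hu : ImageTendsto u l S) (k : ℕ) :
    ImageTendsto (fun i => u i ^ k) l (S ^ k) := by
  induction k with
  | zero =>
    intro B _
    simpa using tendsto_const_nhds
  | succ k ih =>
    simp only [pow_succ]
    exact ih.mul hu

theorem zpow [IsFiniteMeasure μ] (hu : ImageTendsto u l S) (k : ℤ) :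
    ImageTendsto (fun i => u i ^ k) l (S ^ k) := by
  obtain ⟨n, rfl | rfl⟩ := k.eq_nat_or_neg
  · simpa using hu.pow n
  · simpa using (hu.pow n).inv

theorem halmosDist [IsProbabilityMeasure μ] (hu : ImageTendsto u l S) {A : ℕ → Set X}
    (hA : ∀ i, MeasurableSet (A i)) : Tendsto (fun i => halmosDist A (u i) S) l (𝓝 0) := by
  refine tendsto_halmosDist_of_halmosTerm fun i => ?_
  have h := (hu _ (hA i)).add (hu.inv _ (hA i))
  rwa [add_zero] at h

end ImageTendsto

theorem measureReal_symmDiff_image_le [IsProbabilityMeasure μ] (A : ℕ → Set X)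
    (S T : MeasureAut μ) (i : ℕ) :
    μ.real (image S (A i) ∆ image T (A i)) ≤ 2 ^ i * halmosDist A S T := by
  have h := (summable_halmos A S T).le_tsum i
    fun j _ => mul_nonneg (by positivity) (halmosTerm_nonneg A S T j)
  have h1 : μ.real (image S (A i) ∆ image T (A i)) ≤ halmosTerm A S T i :=
    le_add_of_nonneg_right measureReal_nonneg
  calc μ.real (image S (A i) ∆ image T (A i)) ≤ halmosTerm A S T i := h1
    _ = 2 ^ i * ((1 / 2 : ℝ) ^ i * halmosTerm A S T i) := by
      rw [← mul_assoc, ← mul_pow]; norm_num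
    _ ≤ _ := mul_le_mul_of_nonneg_left h (by positivity)

theorem measureReal_symmDiff_image_le_add [IsProbabilityMeasure μ] (S T : MeasureAut μ)
    {B C : Set X} (hB : MeasurableSet B) (hC : MeasurableSet C) :
    μ.real (image S B ∆ image T B) ≤ 2 * μ.real (C ∆ B) + μ.real (image S C ∆ image T C) := by
  have h1 := measureReal_symmDiff_le (μ := μ) (s := image S B) (t := image S C) (image T B)
  have h2 := measureReal_symmDiff_le (μ := μ) (s := image S C) (t := image T C) (image T B)
  rw [measureReal_symmDiff_image S hB hC, symmDiff_comm B] at h1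
  rw [measureReal_symmDiff_image T hC hB] at h2
  linarith

theorem imageTendsto_of_halmosDist [IsProbabilityMeasure μ] {A : ℕ → Set X}
    (hA : IsDenseSetSeq μ A) {ι : Type*} {u : ι → MeasureAut μ} {l : Filter ι} {S : MeasureAut μ}
    (h : Tendsto (fun i => halmosDist A (u i) S) l (𝓝 0)) : ImageTendsto u l S := by
  intro B hB
  rw [Metric.tendsto_nhds]
  intro ε hε
  obtain ⟨i, hi⟩ := hA.2 B hB (ε / 4) (by linarith)
  have h2 := (h.const_mul (2 ^ i)).eventually_lt_const (u := ε / 2) (by simpa using hε)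
  filter_upwards [h2] with j hj
  rw [Real.dist_0_eq_abs, abs_of_nonneg measureReal_nonneg]
  have h3 := measureReal_symmDiff_image_le A (u j) S i
  have h4 := measureReal_symmDiff_image_le_add (u j) S hB (hA.1 i)
  linarith

theorem halmosDist_inv (A : ℕ → Set X) (S T : MeasureAut μ) :
    halmosDist A S⁻¹ T⁻¹ = halmosDist A S T := by
  unfold halmosDist halmosTerm
  simp only [inv_inv, add_comm]

theorem image_cauchy_of_halmosDist [IsProbabilityMeasure μ] {A : ℕ → Set X}
    (hA : IsDenseSetSeq μ A) {u : ℕ → MeasureAut μ}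
    (hu : ∀ ε : ℝ, 0 < ε → ∃ N, ∀ n ≥ N, ∀ m ≥ N, halmosDist A (u n) (u m) < ε)
    {C : Set X} (hC : MeasurableSet C) {ε : ℝ} (hε : 0 < ε) :
    ∃ N, ∀ n ≥ N, ∀ m ≥ N, μ.real (image (u n) C ∆ image (u m) C) < ε := by
  obtain ⟨i, hi⟩ := hA.2 C hC (ε / 4) (by linarith)
  obtain ⟨N, hN⟩ := hu (ε / 2 / 2 ^ i) (by positivity)
  refine ⟨N, fun n hn m hm => ?_⟩
  have h3 := measureReal_symmDiff_image_le A (u n) (u m) i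
  have h4 := measureReal_symmDiff_image_le_add (u n) (u m) hC (hA.1 i)
  have h5 := (lt_div_iff₀' (by positivity)).1 (hN n hn m hm)
  linarith

/-- The Halmos metric controls inverses, so both the representatives' inverses and the
representatives of the inverses have limit maps, V and T. Their relation T ∘ V = id almost
everywhere makes V injective on a conull set, hence almost everywhere equal to an isomorphism. -/
theorem exists_imageTendsto_of_cauchy [StandardBorelSpace X] [IsProbabilityMeasure μ]
    [NullSingletonClass μ] {A : ℕ → Set X} (hA : IsDenseSetSeq μ A) {u : ℕ → MeasureAut μ}
    (hu : ∀ ε : ℝ, 0 < ε → ∃ N, ∀ n ≥ N, ∀ m ≥ N, halmosDist A (u n) (u m) < ε) :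
    ∃ S, ImageTendsto u atTop S := by
  obtain ⟨V, hV, hVu⟩ := exists_limit_of_cauchy_preimage hA
    (fun n => measurePreserving_rep_symm (u n)) fun C hC ε hε => by
      simpa only [image_eq_preimage] using image_cauchy_of_halmosDist hA hu hC hε
  obtain ⟨T, hT, hTu⟩ := exists_limit_of_cauchy_preimage hA
    (fun n => measurePreserving_rep_symm (u n)⁻¹) fun C hC ε hε => by
      simpa only [image_eq_preimage] using image_cauchy_of_halmosDist (u := fun n => (u n)⁻¹) hA
        (by simpa only [halmosDist_inv] using hu) hC hε
  simp only [← image_eq_preimage] at hVu hTu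
  have hVT : ∀ C, MeasurableSet C → V ⁻¹' (T ⁻¹' C) =ᵐ[μ] C := by
    intro C hC
    refine ae_eq_of_measureReal_symmDiff_eq_zero (le_antisymm ?_ measureReal_nonneg)
    have h := (hVu _ (hT.measurable hC)).add (hTu C hC)
    rw [add_zero] at h
    refine ge_of_tendsto' h fun n => ?_
    have h1 := measureReal_symmDiff_le (μ := μ) (s := V ⁻¹' (T ⁻¹' C))
      (t := image (u n) (T ⁻¹' C)) C
    have h2 : μ.real (image (u n) (T ⁻¹' C) ∆ C) = μ.real (image (u n)⁻¹ C ∆ (T ⁻¹' C)) := by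
      rw [← measureReal_symmDiff_image (u n) (measurableSet_image _ hC) (hT.measurable hC),
        symmDiff_comm]
      exact measureReal_symmDiff_congr (image_image_inv (u n) C).symm ae_eq_rfl
    rw [symmDiff_comm (V ⁻¹' (T ⁻¹' C)) (image (u n) (T ⁻¹' C))] at h1
    linarith
  -- Countably many generating sets separate points, which turns equality of sets up to null sets
  -- into equality of points almost everywhere.
  have hTV : ∀ᵐ x ∂μ, T (V x) = x := by
    have h : ∀ᵐ x ∂μ, ∀ k, (T (V x) ∈ MeasurableSpace.natGeneratingSequence X k ↔
        x ∈ MeasurableSpace.natGeneratingSequence X k) := by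
      refine ae_all_iff.2 fun k => ?_
      filter_upwards [hVT _ (MeasurableSpace.measurableSet_natGeneratingSequence k)] with x hx
      exact iff_of_eq hx
    filter_upwards [h] with x hx
    exact MeasurableSpace.injective_mapNatBool X (funext fun k => decide_eq_decide.2 (hx k))
  obtain ⟨s, hs, hsm, hsμ⟩ : ∃ s ⊆ {x | T (V x) = x}, MeasurableSet s ∧ μ sᶜ = 0 := by
    obtain ⟨t, ht, htm, htμ⟩ := exists_measurable_superset_of_null (ae_iff.1 hTV)
    refine ⟨tᶜ, fun x hx => ?_, htm.compl, by rwa [compl_compl]⟩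
    by_contra h
    exact hx (ht h)
  obtain ⟨θ, hθ, hθV⟩ := exists_measurableEquiv_ae_eq hV hsm hsμ fun x hx y hy hxy => by
    rw [← hs hx, ← hs hy, hxy]
  -- An inverse appears because images under u n are preimages under the maps that converge to V.
  refine ⟨(ofEquiv θ hθ)⁻¹, fun B hB => ?_⟩
  refine (hVu B hB).congr fun n => measureReal_symmDiff_congr ae_eq_rfl ?_
  filter_upwards [hθV, image_inv_ofEquiv θ hθ B] with x hx hx'
  rw [hx']
  change (V x ∈ B) = (θ x ∈ B)
  rw [hx]

theorem completeSpace_halmos [StandardBorelSpace X] [IsProbabilityMeasure μ]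
    [NullSingletonClass μ] {A : ℕ → Set X} (hA : IsDenseSetSeq μ A) :
    @CompleteSpace (MeasureAut μ) (halmosPseudoMetric μ A).toUniformSpace := by
  let := halmosPseudoMetric μ A
  refine Metric.complete_of_cauchySeq_tendsto fun u hu => ?_
  obtain ⟨S, hS⟩ := exists_imageTendsto_of_cauchy hA (u := u) (Metric.cauchySeq_iff.1 hu)
  exact ⟨S, tendsto_iff_dist_tendsto_zero.2 (hS.halmosDist hA.1)⟩

end MeasureAut

/-! ### Triple correlations: open conditions and asymmetry -/

theorem abs_measureReal_inter_inter_sub_le {X : Type*} [MeasurableSpace X] {μ : Measure X}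
    [IsFiniteMeasure μ] {A B C A' B' C' : Set X} (hA : MeasurableSet A) (hB : MeasurableSet B)
    (hC : MeasurableSet C) (hA' : MeasurableSet A') (hB' : MeasurableSet B')
    (hC' : MeasurableSet C') :
    |μ.real (A ∩ B ∩ C) - μ.real (A' ∩ B' ∩ C')| ≤
      μ.real (A ∆ A') + μ.real (B ∆ B') + μ.real (C ∆ C') := by
  refine (abs_measureReal_sub_le_measureReal_symmDiff
    ((hA.inter hB).inter hC).nullMeasurableSet
    ((hA'.inter hB').inter hC').nullMeasurableSet).trans ?_
  refine le_trans (measureReal_mono (s₂ := (A ∆ A') ∪ (B ∆ B') ∪ (C ∆ C')) ?_) ?_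
  · intro x
    simp only [Set.mem_symmDiff, Set.mem_inter_iff, Set.mem_union]
    tauto
  · have h1 := measureReal_union_le (μ := μ) ((A ∆ A') ∪ (B ∆ B')) (C ∆ C')
    have h2 := measureReal_union_le (μ := μ) (A ∆ A') (B ∆ B')
    linarith

namespace MeasureAut

variable {X : Type*} [MeasurableSpace X] {μ : Measure X}

/-- The triple correlation `μ(A ∩ T^a A ∩ T^b A)`. -/
noncomputable def tripleCorr (T : MeasureAut μ) (A : Set X) (a b : ℤ) : ℝ :=
  μ.real (A ∩ image (T ^ a) A ∩ image (T ^ b) A)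

theorem tendsto_tripleCorr [IsFiniteMeasure μ] {ι : Type*} {u : ι → MeasureAut μ} {l : Filter ι}
    {S : MeasureAut μ} (hu : ImageTendsto u l S) {A : Set X} (hA : MeasurableSet A) (a b : ℤ) :
    Tendsto (fun i => tripleCorr (u i) A a b) l (𝓝 (tripleCorr S A a b)) := by
  rw [tendsto_iff_dist_tendsto_zero]
  have h := ((hu.zpow a) A hA).add ((hu.zpow b) A hA)
  rw [add_zero] at h
  refine squeeze_zero (fun _ => dist_nonneg) (fun i => ?_) h
  rw [Real.dist_eq]
  refine (abs_measureReal_inter_inter_sub_le hA (measurableSet_image _ hA)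
    (measurableSet_image _ hA) hA (measurableSet_image _ hA) (measurableSet_image _ hA)).trans ?_
  simp

theorem abs_tripleCorr_sub_le [IsFiniteMeasure μ] (T : MeasureAut μ) {A B : Set X}
    (hA : MeasurableSet A) (hB : MeasurableSet B) (a b : ℤ) :
    |tripleCorr T A a b - tripleCorr T B a b| ≤ 3 * μ.real (A ∆ B) := by
  refine (abs_measureReal_inter_inter_sub_le hA (measurableSet_image _ hA)
    (measurableSet_image _ hA) hB (measurableSet_image _ hB) (measurableSet_image _ hB)).trans ?_
  rw [measureReal_symmDiff_image _ hA hB, measureReal_symmDiff_image _ hA hB]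
  linarith

/-- The automorphisms with approximate asymmetric limits for the first `k` sets of a sequence. -/
def approxLimits (μ : Measure X) (A : ℕ → Set X) (k : ℕ) : Set (MeasureAut μ) :=
  {T | ∃ m n : ℕ, k ≤ m ∧ k ≤ n ∧ ∀ i < k,
    |tripleCorr T (A i) m n - (μ.real (A i) + 2 * μ.real (A i) ^ 3) / 3| < (1 : ℝ) / (k + 1) ∧
    |tripleCorr T (A i) (-m) (-n) - μ.real (A i) ^ 2| < (1 : ℝ) / (k + 1)}

theorem isOpen_approxLimits [IsProbabilityMeasure μ] {A : ℕ → Set X} (hA : IsDenseSetSeq μ A)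
    (k : ℕ) :
    @IsOpen _ (halmosPseudoMetric μ A).toUniformSpace.toTopologicalSpace (approxLimits μ A k) := by
  let := halmosPseudoMetric μ A
  have hcont : ∀ i (a b : ℤ), Continuous fun T : MeasureAut μ => tripleCorr T (A i) a b := by
    intro i a b
    refine continuous_iff_continuousAt.2 fun S => ?_
    have hS : ImageTendsto (fun T : MeasureAut μ => T) (𝓝 S) S :=
      imageTendsto_of_halmosDist hA (tendsto_iff_dist_tendsto_zero.1 tendsto_id)
    exact tendsto_tripleCorr hS (hA.1 i) a b
  have h : approxLimits μ A k = ⋃ (m : ℕ) (n : ℕ) (_ : k ≤ m) (_ : k ≤ n),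
      ⋂ i ∈ Set.Iio k, ({T : MeasureAut μ |
        |tripleCorr T (A i) m n - (μ.real (A i) + 2 * μ.real (A i) ^ 3) / 3| < (1 : ℝ) / (k + 1)} ∩
        {T : MeasureAut μ | |tripleCorr T (A i) (-m) (-n) - μ.real (A i) ^ 2| < (1 : ℝ) / (k + 1)}) := by
    ext T
    simp only [approxLimits, Set.mem_ofPred_eq, Set.mem_iUnion, Set.mem_iInter, Set.mem_inter_iff,
      Set.mem_Iio, exists_prop]
  rw [h]
  refine isOpen_iUnion fun m => isOpen_iUnion fun n => isOpen_iUnion fun _ =>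
    isOpen_iUnion fun _ => (Set.finite_Iio k).isOpen_biInter fun i _ => ?_
  exact (isOpen_lt ((hcont i m n).sub continuous_const).abs continuous_const).inter
    (isOpen_lt ((hcont i (-m) (-n)).sub continuous_const).abs continuous_const)

/-- The m and n chosen for successive k serve all measurable sets at once: correlations and limit
values are 3-Lipschitz in the set, uniformly in k, so convergence on the dense sequence is enough.
-/
theorem hasAsymmetricLimits_of_mem_approxLimits [IsProbabilityMeasure μ] {A : ℕ → Set X}
    (hA : IsDenseSetSeq μ A) {T : MeasureAut μ} (hT : ∀ k, T ∈ approxLimits μ A k) :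
    T.HasAsymmetricLimits := by
  choose m n hm hn hmn using hT
  refine ⟨m, n, tendsto_atTop_mono hm tendsto_id, tendsto_atTop_mono hn tendsto_id,
    fun B hB => ?_⟩
  have key : ∀ (c : ℕ → Set X → ℝ) (p : ℝ → ℝ),
      (∀ k C, MeasurableSet C → |c k B - c k C| ≤ 3 * μ.real (C ∆ B)) →
      (∀ x y, 0 ≤ x → x ≤ 1 → 0 ≤ y → y ≤ 1 → |p x - p y| ≤ 3 * |x - y|) →
      (∀ k, ∀ i < k, |c k (A i) - p (μ.real (A i))| < (1 : ℝ) / (k + 1)) →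
      Tendsto (fun k => c k B) atTop (𝓝 (p (μ.real B))) := by
    intro c p hc hp hcp
    rw [Metric.tendsto_nhds]
    intro ε hε
    -- Replacing B by A i costs at most ε/4 in the correlation and ε/4 in the limit value, leaving
    -- ε/2 for the approximation error 1/(k + 1).
    obtain ⟨i, hi⟩ := hA.2 B hB (ε / 12) (by linarith)
    have h1 := (tendsto_one_div_add_atTop_nhds_zero_nat (𝕜 := ℝ)).eventually_lt_const
      (half_pos hε)
    filter_upwards [h1, eventually_gt_atTop i] with k hk hik
    rw [Real.dist_eq]
    have h2 := hc k (A i) (hA.1 i)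
    have h3 := hcp k i hik
    have h4 := hp (μ.real (A i)) (μ.real B) measureReal_nonneg measureReal_le_one
      measureReal_nonneg measureReal_le_one
    have h5 := abs_measureReal_sub_le_measureReal_symmDiff (μ := μ) (hA.1 i).nullMeasurableSet
      hB.nullMeasurableSet
    have h6 := abs_sub_le (c k B) (c k (A i)) (p (μ.real B))
    have h7 := abs_sub_le (c k (A i)) (p (μ.real (A i))) (p (μ.real B))
    linarith
  refine ⟨key (fun k C => tripleCorr T C (m k) (n k)) (fun x => (x + 2 * x ^ 3) / 3)
    (fun k C hC => ?_) (fun x y hx0 hx1 hy0 hy1 => ?_) (fun k i hi => (hmn k i hi).1),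
    key (fun k C => tripleCorr T C (-m k) (-n k)) (fun x => x ^ 2)
    (fun k C hC => ?_) (fun x y hx0 hx1 hy0 hy1 => ?_) (fun k i hi => (hmn k i hi).2)⟩
  · rw [symmDiff_comm]
    exact abs_tripleCorr_sub_le T hB hC _ _
  · have h : (x + 2 * x ^ 3) / 3 - (y + 2 * y ^ 3) / 3 =
        (1 + 2 * (x ^ 2 + x * y + y ^ 2)) / 3 * (x - y) := by ring
    simp only [h]
    rw [abs_mul]
    refine mul_le_mul_of_nonneg_right ?_ (abs_nonneg _)
    rw [abs_of_nonneg (by positivity)]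
    nlinarith
  · rw [symmDiff_comm]
    exact abs_tripleCorr_sub_le T hB hC _ _
  · have h : x ^ 2 - y ^ 2 = (x + y) * (x - y) := by ring
    simp only [h]
    rw [abs_mul]
    refine mul_le_mul_of_nonneg_right ?_ (abs_nonneg _)
    rw [abs_of_nonneg (by positivity)]
    linarith

theorem HasAsymmetricLimits.isAsymmetric [StandardBorelSpace X] [IsProbabilityMeasure μ]
    [NullSingletonClass μ] {T : MeasureAut μ} (hT : T.HasAsymmetricLimits) : T.IsAsymmetric := by
  intro hconj
  obtain ⟨c, hc⟩ := isConj_iff.1 hconj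
  obtain ⟨m, n, -, -, h⟩ := hT
  -- The polynomials (x + 2x³)/3 and x² agree only at 0, 1/2 and 1; at 1/3 they are 11/81 and 9/81.
  obtain ⟨B, hB, hBμ⟩ := exists_measureReal_eq μ (c := 1 / 3) (by norm_num) (by norm_num)
  have hcB : μ.real (image c B) = 1 / 3 := by rw [measureReal_image c hB, hBμ]
  have hpow : ∀ k : ℤ, image (T ^ (-k)) (image c B) =ᵐ[μ] image c (image (T ^ k) B) := by
    intro k
    have h1 : T ^ (-k) * c = c * T ^ k := by
      rw [zpow_neg, ← inv_zpow, ← hc, conj_zpow]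
      simp
    have h2 := image_mul (T ^ (-k)) c B
    rw [h1] at h2
    exact h2.symm.trans (image_mul c (T ^ k) B)
  have heq : ∀ a b : ℤ, μ.real (image c B ∩ image (T ^ (-a)) (image c B) ∩
      image (T ^ (-b)) (image c B)) = μ.real (B ∩ image (T ^ a) B ∩ image (T ^ b) B) := by
    intro a b
    rw [← measureReal_image c ((hB.inter (measurableSet_image _ hB)).inter
      (measurableSet_image _ hB)), image_inter, image_inter]
    exact measureReal_congr ((ae_eq_rfl.inter (hpow a)).inter (hpow b))
  have h1 := (h B hB).1
  have h2 := (h (image c B) (measurableSet_image c hB)).2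
  simp only [heq] at h2
  have h3 := tendsto_nhds_unique h1 h2
  rw [hBμ, hcB] at h3
  norm_num at h3

end MeasureAut

/-! ### Lifting finitely many sets along a factor map -/

section LiftNames

/-- A finite family of measurable sets can be lifted along a factor map by an isomorphism. -/
theorem exists_measurableEquiv_preimage_ae_eq {X Y : Type*} [MeasurableSpace X]
    [StandardBorelSpace X] [MeasurableSpace Y] [StandardBorelSpace Y] {μ : Measure X}
    {ν : Measure Y} [IsProbabilityMeasure μ] [IsProbabilityMeasure ν] [NullSingletonClass μ]
    [NullSingletonClass ν] {f : Y → X} (hf : MeasurePreserving f ν μ) {ι : Type*} [Finite ι]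
    {B : ι → Set X} (hB : ∀ j, MeasurableSet (B j)) :
    ∃ θ : X ≃ᵐ Y, MeasurePreserving θ μ ν ∧ ∀ j, θ ⁻¹' (f ⁻¹' B j) =ᵐ[μ] B j := by
  classical
  have := Fintype.ofFinite ι
  let c : X → ι → Bool := fun x j => decide (x ∈ B j)
  have hc : Measurable c := by
    refine measurable_pi_iff.2 fun j => measurable_to_bool ?_
    convert hB j using 1
    ext x
    simp [c]
  let e : (ι → Bool) ≃ Fin (Fintype.card (ι → Bool)) := Fintype.equivFin _
  let g : X → ℕ := fun x => e (c x)
  have hg : Measurable g := (Measurable.of_discrete (f := fun w => (e w : ℕ))).comp hc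
  -- The label g x records which of the sets B j contain x. As f preserves measure, g and g ∘ f have
  -- the same distribution.
  obtain ⟨θ, hθ, hθg⟩ := exists_measurableEquiv_comp_ae_eq (μ := μ) (ν := ν) hg
    (hg.comp hf.measurable) (by rw [← Measure.map_map hg hf.measurable, hf.map_eq])
  refine ⟨θ, hθ, fun j => ?_⟩
  filter_upwards [hθg] with x hx
  have h1 : c (f (θ x)) = c x := e.injective (Fin.val_injective hx)
  exact propext (decide_eq_decide.1 (congrFun h1 j))

end LiftNames

/-! ### The cyclic extension by twelve windows -/

namespace WindowExtension

/-- The classes of the twelve windows; the windows `t`, `t - 1` and `t - 5` belong to the same class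
when `3 ∣ t`, and to three different classes otherwise. -/
def cls : Fin 12 → Fin 4 := ![0, 2, 1, 1, 3, 2, 2, 0, 3, 3, 1, 0]

/-- The cyclic step on positions `(t, r)`: window `t` and place `r` in the window. -/
def step (L : ℕ) : Equiv.Perm (Fin 12 × Fin (L + 1)) where
  toFun i := (if i.2 = Fin.last L then i.1 + 1 else i.1, i.2 + 1)
  invFun i := (if i.2 = 0 then i.1 - 1 else i.1, i.2 - 1)
  left_inv i := by
    obtain ⟨t, r⟩ := i
    have hl : Fin.last L = -1 := eq_neg_of_add_eq_zero_left (Fin.last_add_one L)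
    by_cases hr : r = -1
    · simp [hl, hr]
    · simp [hl, hr, add_eq_zero_iff_eq_neg]
  right_inv i := by
    obtain ⟨t, r⟩ := i
    have hl : Fin.last L = -1 := eq_neg_of_add_eq_zero_left (Fin.last_add_one L)
    by_cases hr : r = 0
    · simp [hl, hr]
    · simp [hl, hr, sub_eq_iff_eq_add]

theorem step_apply {L : ℕ} {r : Fin (L + 1)} (hr : r ≠ Fin.last L) (t : Fin 12) :
    step L (t, r) = (t, r + 1) := by simp [step, hr]

theorem step_apply_last (L : ℕ) (t : Fin 12) : step L (t, Fin.last L) = (t + 1, 0) := by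
  simp [step]

theorem step_pow_apply_zero {L : ℕ} (t : Fin 12) (j : ℕ) (hj : j ≤ L) :
    (step L ^ j) (t, 0) = (t, ⟨j, by omega⟩) := by
  induction j with
  | zero => rfl
  | succ j ih =>
    have hne : (⟨j, by omega⟩ : Fin (L + 1)) ≠ Fin.last L := by
      intro h
      have := congrArg Fin.val h
      simp at this
      omega
    rw [pow_succ', Equiv.Perm.mul_apply, ih (by omega), step_apply hne]
    congr 1
    ext
    rw [Fin.val_add_one_of_lt (Fin.lt_last_iff_ne_last.2 hne)]

/-- The case r = 0 extends to every place because (t, r) is reached from (t, 0) by a power of the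
step, and powers commute. -/
theorem step_pow_window (L : ℕ) (t : Fin 12) (r : Fin (L + 1)) :
    (step L ^ (L + 1)) (t, r) = (t + 1, r) := by
  have h0 : (step L ^ (L + 1)) (t, 0) = (t + 1, 0) := by
    rw [pow_succ', Equiv.Perm.mul_apply, step_pow_apply_zero t L le_rfl]
    exact step_apply_last L t
  have h1 := step_pow_apply_zero t r.val (Nat.le_of_lt_succ r.2)
  have h2 := step_pow_apply_zero (t + 1) r.val (Nat.le_of_lt_succ r.2)
  calc (step L ^ (L + 1)) (t, r) = (step L ^ (L + 1)) ((step L ^ r.val) (t, 0)) := by rw [h1]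
    _ = (step L ^ r.val) ((step L ^ (L + 1)) (t, 0)) := by
      rw [← Equiv.Perm.mul_apply, ← Equiv.Perm.mul_apply, pow_mul_comm]
    _ = (t + 1, r) := by rw [h0, h2]

/-- Translation of the window by `c`. -/
def shift (L : ℕ) (c : Fin 12) : Equiv.Perm (Fin 12 × Fin (L + 1)) where
  toFun i := (i.1 + c, i.2)
  invFun i := (i.1 - c, i.2)
  left_inv i := by simp
  right_inv i := by simp

theorem step_pow_eq_shift (L : ℕ) : step L ^ (L + 1) = shift L 1 :=
  Equiv.ext fun i => step_pow_window L i.1 i.2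

theorem shift_mul (L : ℕ) (c d : Fin 12) : shift L c * shift L d = shift L (d + c) :=
  Equiv.ext fun i => by simp [shift, add_assoc]

theorem shift_inv (L : ℕ) (c : Fin 12) : (shift L c)⁻¹ = shift L (-c) := by
  rw [inv_eq_iff_mul_eq_one, shift_mul]
  ext i <;> simp [shift]

theorem step_pow_eq_shift_five (L : ℕ) : step L ^ (5 * (L + 1)) = shift L 5 := by
  rw [mul_comm, pow_mul, step_pow_eq_shift]
  simp only [pow_succ, pow_zero, one_mul, shift_mul]
  rfl

/-- The product of four independent copies of `X` with the space of positions. -/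
abbrev Space (X : Type*) (L : ℕ) : Type _ := (Fin 4 → X) × (Fin 12 × Fin (L + 1))

/-- The factor map: the coordinate of the class of the window, moved by the place. -/
def factor {X : Type*} (s : Equiv.Perm X) (L : ℕ) (y : Space X L) : X :=
  (s ^ (y.2.2 : ℕ)) (y.1 (cls y.2.1))

/-- The action of a permutation of positions on the extension. -/
def lift (X : Type*) {L : ℕ} (σ : Equiv.Perm (Fin 12 × Fin (L + 1))) : Equiv.Perm (Space X L) :=
  (Equiv.refl _).prodCongr σ

theorem lift_pow (X : Type*) {L : ℕ} (σ : Equiv.Perm (Fin 12 × Fin (L + 1))) (k : ℕ) :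
    lift X σ ^ k = lift X (σ ^ k) := by
  let F : Equiv.Perm (Fin 12 × Fin (L + 1)) →* Equiv.Perm (Space X L) :=
    { toFun := lift X, map_one' := rfl, map_mul' := fun _ _ => rfl }
  exact (map_pow F σ k).symm

theorem lift_inv (X : Type*) {L : ℕ} (σ : Equiv.Perm (Fin 12 × Fin (L + 1))) :
    (lift X σ)⁻¹ = lift X σ⁻¹ := rfl

/-- Away from the last place the step is seen on X as s. The exceptional places have total measure
1/(L + 1), which bounds how far the transported step is from s. -/
theorem factor_lift_step {X : Type*} (s : Equiv.Perm X) {L : ℕ} {y : Space X L} (hy : y.2.2 ≠ Fin.last L) :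
    factor s L (lift X (step L) y) = s (factor s L y) := by
  obtain ⟨α, t, r⟩ := y
  have h : lift X (step L) (α, (t, r)) = (α, (t, r + 1)) := by
    change (α, step L (t, r)) = _
    rw [step_apply hy]
  rw [h]
  simp only [factor]
  rw [Fin.val_add_one_of_lt (Fin.lt_last_iff_ne_last.2 hy), pow_succ', Equiv.Perm.mul_apply]

variable {X : Type*} [MeasurableSpace X]

/-- The product measure, uniform on positions. -/
noncomputable def measure (μ : Measure X) (L : ℕ) : Measure (Space X L) :=
  (Measure.pi fun _ : Fin 4 => μ).prod
    (ProbabilityTheory.uniformOn (Set.univ : Set (Fin 12 × Fin (L + 1))))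

instance (L : ℕ) : IsProbabilityMeasure
    (ProbabilityTheory.uniformOn (Set.univ : Set (Fin 12 × Fin (L + 1)))) :=
  ProbabilityTheory.isProbabilityMeasure_uniformOn Set.finite_univ Set.univ_nonempty

instance (μ : Measure X) [IsProbabilityMeasure μ] (L : ℕ) : IsProbabilityMeasure (measure μ L) := by
  unfold measure; infer_instance

instance (μ : Measure X) [IsProbabilityMeasure μ] [NullSingletonClass μ] (L : ℕ) :
    NullSingletonClass (measure μ L) := by
  unfold measure; infer_instance

theorem measureReal_eq_sum (μ : Measure X) [IsProbabilityMeasure μ] {L : ℕ}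
    {E : Set (Space X L)} (hE : MeasurableSet E) :
    (measure μ L).real E =
      (∑ i, (Measure.pi fun _ : Fin 4 => μ).real ((fun α => (α, i)) ⁻¹' E)) / (12 * (L + 1)) := by
  have h1 : ∀ i : Fin 12 × Fin (L + 1),
      (ProbabilityTheory.uniformOn (Set.univ : Set (Fin 12 × Fin (L + 1)))) {i} =
        ENNReal.ofReal (1 / (12 * (L + 1))) := by
    intro i
    rw [ProbabilityTheory.uniformOn_univ, Measure.count_singleton, Fintype.card_prod,
      Fintype.card_fin, Fintype.card_fin, one_div, one_div,
      ENNReal.ofReal_inv_of_pos (by positivity)]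
    have h2 : (12 * (L + 1) : ℝ) = ((12 * (L + 1) : ℕ) : ℝ) := by push_cast; ring
    rw [h2, ENNReal.ofReal_natCast]
  rw [measureReal_def, measure, Measure.prod_apply_symm hE, lintegral_fintype,
    ENNReal.toReal_sum (fun i _ => ENNReal.mul_ne_top (measure_ne_top _ _) (measure_ne_top _ _)),
    Finset.sum_div]
  refine Finset.sum_congr rfl fun i _ => ?_
  rw [ENNReal.toReal_mul, h1, ENNReal.toReal_ofReal (by positivity), ← measureReal_def]
  ring

theorem measurable_perm_pow {s : Equiv.Perm X} (hs : Measurable s) (n : ℕ) :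
    Measurable (s ^ n : Equiv.Perm X) := by
  rw [Equiv.Perm.coe_pow]
  exact hs.iterate n

theorem measurePreserving_perm_pow {μ : Measure X} {s : Equiv.Perm X}
    (hs : MeasurePreserving s μ μ) (n : ℕ) :
    MeasurePreserving (s ^ n : Equiv.Perm X) μ μ := by
  rw [Equiv.Perm.coe_pow]
  exact hs.iterate n

theorem measurable_factor {s : Equiv.Perm X} (hs : Measurable s) (L : ℕ) :
    Measurable (factor s L) := by
  refine measurable_from_prod_countable_left fun i => ?_
  have h : Measurable fun α : Fin 4 → X => α (cls i.1) := measurable_pi_apply _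
  exact (measurable_perm_pow hs (i.2 : ℕ)).comp h

/-- The triple of windows `t`, `t - a`, `t - b` depends on as many independent coordinates as it has
classes. -/
theorem measureReal_factor_triple {μ : Measure X} [IsProbabilityMeasure μ] {s : Equiv.Perm X}
    (hs : MeasurePreserving s μ μ) (L : ℕ) {A : Set X} (hA : MeasurableSet A) (a b : Fin 12) :
    (measure μ L).real {y | factor s L y ∈ A ∧ factor s L (y.1, (y.2.1 - a, y.2.2)) ∈ A ∧
        factor s L (y.1, (y.2.1 - b, y.2.2)) ∈ A} =
      (∑ t : Fin 12, μ.real A ^ ({cls t, cls (t - a), cls (t - b)} : Finset (Fin 4)).card) / 12 := by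
  have hm : ∀ c : Fin 12, Measurable fun y : Space X L => factor s L (y.1, (y.2.1 - c, y.2.2)) :=
    fun c => (measurable_factor hs.measurable L).comp
      (measurable_fst.prodMk ((Measurable.of_discrete (f := fun i : Fin 12 × Fin (L + 1) => (i.1 - c, i.2))).comp
        measurable_snd))
  have hE : MeasurableSet {y : Space X L | factor s L y ∈ A ∧
      factor s L (y.1, (y.2.1 - a, y.2.2)) ∈ A ∧ factor s L (y.1, (y.2.1 - b, y.2.2)) ∈ A} :=
    (measurable_factor hs.measurable L hA).inter ((hm a hA).inter (hm b hA))
  rw [measureReal_eq_sum μ hE]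
  have hslice : ∀ i : Fin 12 × Fin (L + 1), (Measure.pi fun _ : Fin 4 => μ).real
      ((fun α => ((α, i) : Space X L)) ⁻¹' {y | factor s L y ∈ A ∧
        factor s L (y.1, (y.2.1 - a, y.2.2)) ∈ A ∧ factor s L (y.1, (y.2.1 - b, y.2.2)) ∈ A}) =
      μ.real A ^ ({cls i.1, cls (i.1 - a), cls (i.1 - b)} : Finset (Fin 4)).card := by
    rintro ⟨t, r⟩
    -- All three windows are read at the same place r, so windows of one class impose the same
    -- condition on one coordinate, and the slice is a box with one factor s^{-r}A per distinct
    -- class.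
    have hset : ((fun α => ((α, (t, r)) : Space X L)) ⁻¹' {y | factor s L y ∈ A ∧
        factor s L (y.1, (y.2.1 - a, y.2.2)) ∈ A ∧ factor s L (y.1, (y.2.1 - b, y.2.2)) ∈ A}) =
        Set.univ.pi fun c => if c ∈ ({cls t, cls (t - a), cls (t - b)} : Finset (Fin 4)) then
          (s ^ (r : ℕ) : Equiv.Perm X) ⁻¹' A else Set.univ := by
      ext α
      simp only [factor, Set.mem_preimage, Set.mem_ofPred_eq, Set.mem_pi, Set.mem_univ,
        forall_true_left]
      constructor
      · rintro ⟨h1, h2, h3⟩ c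
        split_ifs with hc
        · simp only [Finset.mem_insert, Finset.mem_singleton] at hc
          rcases hc with rfl | rfl | rfl <;> assumption
        · trivial
      · intro h
        refine ⟨?_, ?_, ?_⟩
        · simpa using h (cls t)
        · simpa using h (cls (t - a))
        · simpa using h (cls (t - b))
    rw [hset, measureReal_def, Measure.pi_pi, ENNReal.toReal_prod]
    have : ∀ c : Fin 4, (μ (if c ∈ ({cls t, cls (t - a), cls (t - b)} : Finset (Fin 4)) then
          (s ^ (r : ℕ) : Equiv.Perm X) ⁻¹' A else Set.univ)).toReal =
        if c ∈ ({cls t, cls (t - a), cls (t - b)} : Finset (Fin 4)) then μ.real A else 1 := by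
      intro c
      split_ifs
      · rw [(measurePreserving_perm_pow hs r).measure_preimage hA.nullMeasurableSet,
          measureReal_def]
      · simp
    simp only [this]
    rw [Finset.prod_ite_mem, Finset.univ_inter, Finset.prod_const]
  simp only [hslice]
  rw [Fintype.sum_prod_type]
  simp only [Finset.sum_const, Finset.card_univ, Fintype.card_fin, nsmul_eq_mul]
  rw [← Finset.mul_sum]
  push_cast
  field_simp

/-- Each class contains one multiple u of 3 and is {u, u - 1, u - 5}. -/
theorem card_cls_forward (t : Fin 12) :
    ({cls t, cls (t - 1), cls (t - 5)} : Finset (Fin 4)).card =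
      if t.val % 3 = 0 then 1 else 3 := by
  revert t; decide

/-- Among t, t + 1, t + 5 exactly one pair shares a class {u, u - 1, u - 5}: t + 1 and t + 5 if 3 ∣
t (with u = t + 6), t and t + 5 if t ≡ 1 mod 3, t and t + 1 if t ≡ 2 mod 3. -/
theorem card_cls_backward (t : Fin 12) :
    ({cls t, cls (t - -1), cls (t - -5)} : Finset (Fin 4)).card = 2 := by
  revert t; decide

theorem measurePreserving_factor {μ : Measure X} [IsProbabilityMeasure μ] {s : Equiv.Perm X}
    (hs : MeasurePreserving s μ μ) (L : ℕ) : MeasurePreserving (factor s L) (measure μ L) μ := by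
  refine ⟨measurable_factor hs.measurable L, ?_⟩
  have := Measure.isProbabilityMeasure_map (μ := measure μ L)
    (measurable_factor hs.measurable L).aemeasurable
  ext A hA
  rw [Measure.map_apply (measurable_factor hs.measurable L) hA]
  refine (ENNReal.toReal_eq_toReal_iff' (measure_ne_top _ _) (measure_ne_top _ _)).1 ?_
  -- With both displacements zero the triple collapses to a single window, so one class and the
  -- first power of μ(A).
  have h := measureReal_factor_triple hs L hA 0 0
  simp only [sub_zero, and_self, Finset.mem_singleton, Finset.insert_eq_of_mem,
    Finset.card_singleton, pow_one, Finset.sum_const, Finset.card_univ, Fintype.card_fin,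
    nsmul_eq_mul] at h
  rw [← measureReal_def, ← measureReal_def]
  refine h.trans ?_
  push_cast
  field_simp

theorem measurePreserving_lift (μ : Measure X) [IsProbabilityMeasure μ] {L : ℕ}
    (σ : Equiv.Perm (Fin 12 × Fin (L + 1))) :
    MeasurePreserving (lift X σ) (measure μ L) (measure μ L) := by
  have hm : Measurable (lift X σ) :=
    measurable_fst.prodMk (Measurable.of_discrete.comp measurable_snd)
  refine ⟨hm, ?_⟩
  have := Measure.isProbabilityMeasure_map (μ := measure μ L) hm.aemeasurable
  ext E hE
  rw [Measure.map_apply hm hE]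
  refine (ENNReal.toReal_eq_toReal_iff' (measure_ne_top _ _) (measure_ne_top _ _)).1 ?_
  rw [← measureReal_def, ← measureReal_def, measureReal_eq_sum μ (hm hE), measureReal_eq_sum μ hE]
  congr 1
  exact Equiv.sum_comp σ fun i => (Measure.pi fun _ : Fin 4 => μ).real ((fun α => (α, i)) ⁻¹' E)

theorem measureReal_place (μ : Measure X) [IsProbabilityMeasure μ] {L : ℕ} (r : Fin (L + 1)) :
    (measure μ L).real {y | y.2.2 = r} = 1 / (L + 1) := by
  have hm : MeasurableSet {y : Space X L | y.2.2 = r} :=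
    (measurable_snd.comp measurable_snd) (measurableSet_singleton r)
  rw [measureReal_eq_sum μ hm, Fintype.sum_prod_type]
  have : ∀ (t : Fin 12) (r' : Fin (L + 1)), (Measure.pi fun _ : Fin 4 => μ).real
      ((fun α => ((α, (t, r')) : Space X L)) ⁻¹' {y | y.2.2 = r}) = if r' = r then 1 else 0 := by
    intro t r'
    split_ifs with h
    · simp [h]
    · simp [h]
  simp only [this]
  simp
  field_simp

end WindowExtension

/-! ### Transport to X and density -/

namespace MeasureAut

variable {X Y : Type*} [MeasurableSpace X] [MeasurableSpace Y] {μ : Measure X} {ν : Measure Y}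

/-- The automorphism of `X` that corresponds to a permutation of `Y` under an isomorphism. -/
def conj (θ : X ≃ᵐ Y) (hθ : MeasurePreserving θ μ ν) (Φ : Equiv.Perm Y)
    (hΦ : MeasurePreserving Φ ν ν) (hΦ' : MeasurePreserving Φ.symm ν ν) : MeasureAut μ :=
  QuotientGroup.mk (⟨θ.toEquiv.symm.permCongrHom Φ, (hθ.symm θ).comp (hΦ.comp hθ),
    (hθ.symm θ).comp (hΦ'.comp hθ)⟩ : mpGroup μ)

theorem image_conj_zpow {θ : X ≃ᵐ Y} (hθ : MeasurePreserving θ μ ν) {Φ : Equiv.Perm Y}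
    (hΦ : MeasurePreserving Φ ν ν) (hΦ' : MeasurePreserving Φ.symm ν ν) {A : Set X} {B : Set Y}
    (hAB : θ ⁻¹' B =ᵐ[μ] A) (k : ℤ) :
    image (conj θ hθ Φ hΦ hΦ' ^ k) A =ᵐ[μ] θ ⁻¹' ((Φ ^ k).symm ⁻¹' B) := by
  refine (image_congr _ hAB.symm).trans ?_
  rw [conj, ← QuotientGroup.mk_zpow]
  refine (image_mk _ _).trans (Eventually.of_forall fun x => ?_)
  rw [Subgroup.coe_zpow]
  change ((θ.toEquiv.symm.permCongrHom Φ ^ k : Equiv.Perm X) '' (θ ⁻¹' B)) x = _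
  rw [← map_zpow, Equiv.image_eq_preimage_symm]
  change (θ (θ.symm ((Φ ^ k).symm (θ x))) ∈ B) = _
  rw [θ.apply_symm_apply]
  rfl

theorem tripleCorr_conj {θ : X ≃ᵐ Y} (hθ : MeasurePreserving θ μ ν) {Φ : Equiv.Perm Y}
    (hΦ : MeasurePreserving Φ ν ν) (hΦ' : MeasurePreserving Φ.symm ν ν) {A : Set X} {B : Set Y}
    (hAB : θ ⁻¹' B =ᵐ[μ] A) (a b : ℤ) :
    tripleCorr (conj θ hθ Φ hΦ hΦ') A a b =
      ν.real {y | y ∈ B ∧ (Φ ^ a).symm y ∈ B ∧ (Φ ^ b).symm y ∈ B} := by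
  have h := (hAB.symm.inter (image_conj_zpow hθ hΦ hΦ' hAB a)).inter
    (image_conj_zpow hθ hΦ hΦ' hAB b)
  rw [tripleCorr, measureReal_congr h, Set.inter_assoc, measureReal_def, measureReal_def,
    ← hθ.measure_preimage_equiv]
  rfl

theorem image_inv_eq_preimage (S : MeasureAut μ) (A : Set X) :
    image S⁻¹ A =ᵐ[μ] rep S ⁻¹' A := by
  have h := image_inv_image S (rep S ⁻¹' A)
  rwa [image_eq_preimage S, ← Set.preimage_comp, Equiv.self_comp_symm, Set.preimage_id] at h

/-- T is the transported cyclic step on windows of length L + 1. Its correlations at one and five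
windows are exact for the chosen sets, and it differs from S only through the window ends. -/
theorem exists_asymmetric_near [StandardBorelSpace X] [IsProbabilityMeasure μ]
    [NullSingletonClass μ] (S : MeasureAut μ) {A : ℕ → Set X} (hA : ∀ i, MeasurableSet (A i))
    (n L : ℕ) :
    ∃ T : MeasureAut μ, ∀ i < n,
      tripleCorr T (A i) (L + 1 : ℕ) (5 * (L + 1) : ℕ) =
        (μ.real (A i) + 2 * μ.real (A i) ^ 3) / 3 ∧
      tripleCorr T (A i) (-(L + 1 : ℕ)) (-(5 * (L + 1) : ℕ)) = μ.real (A i) ^ 2 ∧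
      halmosTerm A T S i ≤ 2 / (L + 1) := by
  have hs : MeasurePreserving (rep S) μ μ := measurePreserving_rep S
  have hf := WindowExtension.measurePreserving_factor hs L
  -- The isomorphism must respect the sets A i for the correlations, and also their images under S
  -- and S⁻¹ for the two halves of the Halmos term.
  let B : Fin n ⊕ Fin n ⊕ Fin n → Set X :=
    Sum.elim (fun i => A i) (Sum.elim (fun i => image S (A i)) fun i => rep S ⁻¹' A i)
  obtain ⟨θ, hθ, hθB⟩ := exists_measurableEquiv_preimage_ae_eq hf (B := B) (by
    rintro (i | i | i)
    · exact hA i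
    · exact measurableSet_image S (hA i)
    · exact hs.measurable (hA i))
  have hΦ := WindowExtension.measurePreserving_lift μ (WindowExtension.step L)
  have hΦ' := WindowExtension.measurePreserving_lift μ (WindowExtension.step L).symm
  refine ⟨conj θ hθ _ hΦ hΦ', fun i hi => ?_⟩
  have hAi : θ ⁻¹' (WindowExtension.factor (rep S) L ⁻¹' A i) =ᵐ[μ] A i :=
    hθB (Sum.inl ⟨i, hi⟩)
  have hSA : θ ⁻¹' (WindowExtension.factor (rep S) L ⁻¹' image S (A i)) =ᵐ[μ] image S (A i) :=
    hθB (Sum.inr (Sum.inl ⟨i, hi⟩))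
  have hSA' : θ ⁻¹' (WindowExtension.factor (rep S) L ⁻¹' (rep S ⁻¹' A i)) =ᵐ[μ] rep S ⁻¹' A i :=
    hθB (Sum.inr (Sum.inr ⟨i, hi⟩))
  refine ⟨?_, ?_, ?_⟩
  · rw [tripleCorr_conj hθ hΦ hΦ' hAi, zpow_natCast, zpow_natCast, WindowExtension.lift_pow,
      WindowExtension.lift_pow, WindowExtension.step_pow_eq_shift,
      WindowExtension.step_pow_eq_shift_five]
    refine (WindowExtension.measureReal_factor_triple hs L (hA i) 1 5).trans ?_
    simp only [WindowExtension.card_cls_forward]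
    simp [Fin.sum_univ_succ]
    ring
  · rw [tripleCorr_conj hθ hΦ hΦ' hAi, zpow_neg, zpow_neg, zpow_natCast, zpow_natCast,
      WindowExtension.lift_pow, WindowExtension.lift_pow, WindowExtension.step_pow_eq_shift,
      WindowExtension.step_pow_eq_shift_five, WindowExtension.lift_inv, WindowExtension.lift_inv,
      WindowExtension.shift_inv, WindowExtension.shift_inv]
    refine (WindowExtension.measureReal_factor_triple hs L (hA i) (-1) (-5)).trans ?_
    simp only [WindowExtension.card_cls_backward]
    simp
  · have hbound : ∀ (P Q : Set (WindowExtension.Space X L)) (r : Fin (L + 1)),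
        (∀ y, y.2.2 ≠ r → (y ∈ P ↔ y ∈ Q)) → μ.real ((θ ⁻¹' P) ∆ (θ ⁻¹' Q)) ≤ 1 / (L + 1) := by
      intro P Q r h
      rw [← Set.preimage_symmDiff, measureReal_def, hθ.measure_preimage_equiv, ← measureReal_def,
        ← WindowExtension.measureReal_place μ r]
      refine measureReal_mono fun y hy => ?_
      by_contra hr
      have := h y hr
      rw [Set.mem_symmDiff] at hy
      tauto
    have h1 := image_conj_zpow hθ hΦ hΦ' hAi 1
    have h2 := image_conj_zpow hθ hΦ hΦ' hAi (-1)
    rw [zpow_one, zpow_one] at h1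
    rw [zpow_neg_one, zpow_neg_one] at h2
    have hstep : ∀ y : WindowExtension.Space X L, y.2.2 ≠ Fin.last L → ∀ C : Set X,
        WindowExtension.factor (rep S) L (WindowExtension.lift X (WindowExtension.step L) y) ∈ C ↔
          rep S (WindowExtension.factor (rep S) L y) ∈ C := fun y hy C => by
      rw [WindowExtension.factor_lift_step _ hy]
    unfold halmosTerm
    rw [measureReal_symmDiff_congr h1 hSA.symm,
      measureReal_symmDiff_congr h2 ((image_inv_eq_preimage S (A i)).trans hSA'.symm)]
    -- Backwards the factor map fails to intertwine at place 0, where the previous position is the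
    -- last place of another window.
    have h3 := hbound ((WindowExtension.lift X (WindowExtension.step L)).symm ⁻¹'
      (WindowExtension.factor (rep S) L ⁻¹' A i))
      (WindowExtension.factor (rep S) L ⁻¹' image S (A i)) 0 fun y hy => by
        obtain ⟨z, rfl⟩ := (WindowExtension.lift X (WindowExtension.step L)).surjective y
        have hz : z.2.2 ≠ Fin.last L := by
          intro h
          apply hy
          change z.2.2 + 1 = 0
          rw [h, Fin.last_add_one]
        rw [Set.mem_preimage, Equiv.symm_apply_apply, Set.mem_preimage, Set.mem_preimage,
          hstep z hz, image_eq_preimage, Set.mem_preimage, Equiv.symm_apply_apply]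
    have h4 := hbound ((WindowExtension.lift X (WindowExtension.step L))⁻¹.symm ⁻¹'
      (WindowExtension.factor (rep S) L ⁻¹' A i))
      (WindowExtension.factor (rep S) L ⁻¹' (rep S ⁻¹' A i)) (Fin.last L)
      fun y hy => hstep y hy (A i)
    have h5 : (2 : ℝ) / (L + 1) = 1 / (L + 1) + 1 / (L + 1) := by ring
    rw [h5]
    exact add_le_add h3 h4

/-- Along n the automorphisms near S treat the first n sets with windows of length n + k + 1. Each
Halmos term then tends to zero, while both return times are at least k. -/
theorem dense_approxLimits [StandardBorelSpace X] [IsProbabilityMeasure μ]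
    [NullSingletonClass μ] {A : ℕ → Set X} (hA : ∀ i, MeasurableSet (A i)) (k : ℕ) :
    @Dense _ (halmosPseudoMetric μ A).toUniformSpace.toTopologicalSpace (approxLimits μ A k) := by
  let := halmosPseudoMetric μ A
  intro S
  choose u hu using fun n => exists_asymmetric_near S hA n (n + k)
  have hlim : Tendsto u atTop (𝓝 S) := by
    refine tendsto_iff_dist_tendsto_zero.2 (tendsto_halmosDist_of_halmosTerm fun i => ?_)
    have h0 : Tendsto (fun n : ℕ => (2 : ℝ) * (1 / ((n : ℝ) + 1))) atTop (𝓝 0) := by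
      simpa using (tendsto_one_div_add_atTop_nhds_zero_nat (𝕜 := ℝ)).const_mul 2
    refine squeeze_zero' (Eventually.of_forall fun n => halmosTerm_nonneg A _ _ i) ?_ h0
    filter_upwards [eventually_gt_atTop i] with n hn
    refine (hu n i hn).2.2.trans ?_
    rw [mul_one_div]
    refine div_le_div_of_nonneg_left (by norm_num) (by positivity) ?_
    push_cast
    linarith [(Nat.cast_nonneg k : (0 : ℝ) ≤ k)]
  refine mem_closure_of_tendsto hlim ?_
  -- Once n ≥ k the first k sets are among those with exact correlations, so the errors are zero.
  filter_upwards [eventually_ge_atTop k] with n hn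
  refine ⟨n + k + 1, 5 * (n + k + 1), by omega, by omega, fun i hi => ?_⟩
  obtain ⟨h1, h2, -⟩ := hu n i (hi.trans_le hn)
  rw [h1, h2, sub_self, sub_self, abs_zero]
  exact ⟨by positivity, by positivity⟩

end MeasureAut

theorem mainTheorem7 {X : Type*} [MeasurableSpace X] [StandardBorelSpace X]
    (μ : Measure X) [IsProbabilityMeasure μ] [NullSingletonClass μ] :
    (∀ T : MeasureAut μ, T.HasAsymmetricLimits → T.IsAsymmetric) ∧
      ∀ A : ℕ → Set X, IsDenseSetSeq μ A →
        MeasureAut.IsTypical A {T : MeasureAut μ | T.HasAsymmetricLimits} := by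
  refine ⟨fun T hT => hT.isAsymmetric, fun A hA => ?_⟩
  let := MeasureAut.halmosPseudoMetric μ A
  have : CompleteSpace (MeasureAut μ) := MeasureAut.completeSpace_halmos hA
  refine ⟨⋂ k, MeasureAut.approxLimits μ A k,
    IsGδ.iInter_of_isOpen fun k => MeasureAut.isOpen_approxLimits hA k,
    dense_iInter_of_isOpen (fun k => MeasureAut.isOpen_approxLimits hA k)
      fun k => MeasureAut.dense_approxLimits hA.1 k, fun T hT => ?_⟩
  exact MeasureAut.hasAsymmetricLimits_of_mem_approxLimits hA (Set.mem_iInter.1 hT)
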